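/- **Notation.** Let $G,H,K$ be finite groups. A $(G,H)$-biset is a finite set with a left $G$-action and a commuting right $H$-action; it is viewed as a left $G\times H$-set via $(g,h)x=gxh^{-1}$. The double Burnside group $B(G,H)=B(G\times H)$ is the Grothendieck group of finite $(G,H)$-bisets under disjoint union, with $\mathbb Z$-basis the elements $[(G\times H)/L]$, $L$ running over the subgroups of $G\times H$ up to conjugacy; a basis element *occurs* in an element of $B(G,H)$ if its coefficient is non-zero. $B^\Delta(G,H)\subseteq B(G,H)$ is the subgroup generated by the classes of bifree bisets (those on which $G$ acts freely from the left and $H$ acts freely from the right). Let $-\cdot_H-\colon B(G,H)\times B(H,K)\to B(G,K)$ be the biadditive map with $[X]\cdot_H[Y]=[X\times_HY]$, where $X\times_HY$ is the set of orbits of $X\times Y$ under $h(x,y)=(xh^{-1},hy)$, and let $-^\circ\colon B(G,H)\to B(H,G)$ be the additive map with $[X]^\circ=[X^\circ]$, where $X^\circ$ is the set $X$ with actions $h\cdot x\cdot g=g^{-1}xh^{-1}$. Let $[G]\in B(G,G)$ be the class of $G$ with left and right multiplication. Put $$B^\Delta_\circ(G,H)=\{\gamma\in B^\Delta(G,H)\mid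 \gamma\cdot_H\gamma^\circ=[G]\text{ and }\gamma^\circ\cdot_G\gamma=[H]\};$$ for $G=H$ this is a group under $\cdot_G$. For an isomorphism $\phi\colon H\to G$ and $V\le H$ put $\Delta(\phi(V),\phi,V)=\{(\phi(v),v)\mid v\in V\}\le G\times H$. An element $\gamma\in B^\Delta(G,H)$ is *uniform* if there is an isomorphism $\phi\colon H\to G$ such that $\gamma$ lies in the $\mathbb Z$-span of the elements $[(G\times H)/\Delta(\phi(V),\phi,V)]$, $V\le H$. Let $B(G)$ be the Burnside ring of $G$. The group $\mathrm{Out}(G)$ acts on $B(G)$ by ring automorphisms determined by $[G/R]\mapsto[G/\phi(R)]$ for $\phi\in\mathrm{Aut}(G)$ and $R\le G$, and hence on the unit group $B(G)^\times$. **Theorem.** Let $G$ and $H$ be finite groups. (a) If $\gamma\in B^\Delta(G,H)$ satisfies $\gamma\cdot_H\gamma^\circ=[G]$, then $\gamma^\circ\cdot_G\gamma=[H]$; in particular $\gamma\in B^\Delta_\circ(G,H)$. (b) The set $B^\Delta_\circ(G,H)$ is finite. (c) The set $B^\Delta_\circ(G,H)$ is non-empty if and only if $G$ and $H$ are isomorphic.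 (d) For each $\gamma\in B^\Delta_\circ(G,H)$ there is an isomorphism $\phi\colon H\to G$, unique up to composition with inner automorphisms of $G$, such that $[(G\times H)/\Delta(G,\phi,H)]$ occurs in $\gamma$. Moreover, if $G$ is nilpotent, then each $\gamma\in B^\Delta_\circ(G,H)$ is uniform. (e) If $G$ is nilpotent, then the group $B^\Delta_\circ(G,G)$ is isomorphic to the semidirect product $B(G)^\times\rtimes\mathrm{Out}(G)$ with respect to the action of $\mathrm{Out}(G)$ on $B(G)^\times$ described above. -/

import Mathlib

universe u

namespace BurnsideBiset

noncomputable section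

/-! ## Finite `G`-sets and their isomorphism classes -/

/-- A finite left `G`-set. -/
structure FinGSet (G : Type u) [Group G] where
  carrier : Type u
  [action : MulAction G carrier]
  [finite : Finite carrier]

attribute [instance] FinGSet.action FinGSet.finite

namespace FinGSet

variable {G H K : Type u} [Group G] [Group H] [Group K]

/-- Isomorphism of finite `G`-sets: there is an equivariant bijection. -/
def Iso (X Y : FinGSet G) : Prop :=
  ∃ e : X.carrier ≃ Y.carrier, ∀ (g : G) (x : X.carrier), e (g • x) = g • e x

theorem Iso.refl (X : FinGSet G) : Iso X X := ⟨Equiv.refl _, fun _ _ => rfl⟩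

theorem Iso.symm {X Y : FinGSet G} : Iso X Y → Iso Y X := by
  rintro ⟨e, he⟩
  refine ⟨e.symm, fun g y => ?_⟩
  rw [Equiv.symm_apply_eq, he, Equiv.apply_symm_apply]

theorem Iso.trans {X Y Z : FinGSet G} : Iso X Y → Iso Y Z → Iso X Z := by
  rintro ⟨e, he⟩ ⟨f, hf⟩
  exact ⟨e.trans f, fun g x => by simp [he, hf]⟩

instance setoid (G : Type u) [Group G] : Setoid (FinGSet G) :=
  ⟨Iso, Iso.refl, Iso.symm, Iso.trans⟩

/-- Disjoint union. -/
def sum (X Y : FinGSet G) : FinGSet G := ⟨X.carrier ⊕ Y.carrier⟩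

/-- The empty `G`-set. -/
def empty (G : Type u) [Group G] : FinGSet G :=
  letI : MulAction G PEmpty.{u + 1} :=
    { smul := fun _ x => x, one_smul := fun _ => rfl, mul_smul := fun _ _ _ => rfl }
  ⟨PEmpty.{u + 1}⟩

/-- Direct product with the diagonal action. -/
def prod (X Y : FinGSet G) : FinGSet G := ⟨X.carrier × Y.carrier⟩

/-- The one-point `G`-set. -/
def point (G : Type u) [Group G] : FinGSet G :=
  letI : MulAction G PUnit.{u + 1} :=
    { smul := fun _ x => x, one_smul := fun _ => rfl, mul_smul := fun _ _ _ => rfl }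
  ⟨PUnit.{u + 1}⟩

/-- The transitive `G`-set `G/L`. -/
def coset [Finite G] (L : Subgroup G) : FinGSet G := ⟨G ⧸ L⟩

/-- The `G`-set `X` with `g` acting as `φ⁻¹(g)` acts on `X`. -/
def twist (φ : MulAut G) (X : FinGSet G) : FinGSet G :=
  letI : MulAction G X.carrier := MulAction.compHom X.carrier (φ⁻¹ : MulAut G).toMonoidHom
  ⟨X.carrier⟩

/-! A `(G, H)`-biset is regarded as a left `(G × H)`-set via `(g, h) • x = g x h⁻¹`. -/

/-- `X` is bifree: `G` acts freely on the left and `H` acts freely on the right. -/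
def IsBifree (X : FinGSet (G × H)) : Prop :=
  (∀ (g : G) (x : X.carrier), ((g, 1) : G × H) • x = x → g = 1) ∧
  (∀ (h : H) (x : X.carrier), ((1, h) : G × H) • x = x → h = 1)

/-- The opposite biset: the set `X` with `h x g := g⁻¹ x h⁻¹`. -/
def op (X : FinGSet (G × H)) : FinGSet (H × G) :=
  letI : MulAction (H × G) X.carrier :=
    MulAction.compHom X.carrier (MulEquiv.prodComm : H × G ≃* G × H).toMonoidHom
  ⟨X.carrier⟩

/-- The group `G` as `(G, G)`-biset by left and right multiplication. -/
def regular (G : Type u) [Group G] [Finite G] : FinGSet (G × G) :=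
  letI : MulAction (G × G) G :=
    { smul := fun p x => p.1 * x * p.2⁻¹
      one_smul := fun x => by change 1 * x * 1⁻¹ = x; simp
      mul_smul := fun p q x => by
        change (p.1 * q.1) * x * (p.2 * q.2)⁻¹ = p.1 * (q.1 * x * q.2⁻¹) * p.2⁻¹
        group }
  ⟨G⟩

/-- Orbits of the `H`-action `h (x, y) = (x h⁻¹, h y)` on `X × Y`. -/
def tensorSetoid (X : FinGSet (G × H)) (Y : FinGSet (H × K)) :
    Setoid (X.carrier × Y.carrier) where
  r p q := ∃ h : H, q = (((1, h) : G × H) • p.1, ((h, 1) : H × K) • p.2)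
  iseqv :=
    { refl := fun p => ⟨1, by
        rw [← Prod.one_eq_mk, ← Prod.one_eq_mk, one_smul, one_smul]⟩
      symm := by
        rintro ⟨a, b⟩ ⟨c, d⟩ ⟨h, hh⟩
        obtain ⟨rfl, rfl⟩ := Prod.mk.inj hh
        refine ⟨h⁻¹, ?_⟩
        simp [smul_smul, ← Prod.one_eq_mk]
      trans := by
        rintro ⟨a, b⟩ ⟨c, d⟩ ⟨e, f⟩ ⟨h, hh⟩ ⟨k, hk⟩
        obtain ⟨rfl, rfl⟩ := Prod.mk.inj hh
        obtain ⟨rfl, rfl⟩ := Prod.mk.inj hk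
        exact ⟨k * h, by simp [smul_smul]⟩ }

/-- The set `X ×_H Y`. -/
def TensorCarrier (X : FinGSet (G × H)) (Y : FinGSet (H × K)) : Type u :=
  Quotient (tensorSetoid X Y)

instance (X : FinGSet (G × H)) (Y : FinGSet (H × K)) : Finite (TensorCarrier X Y) :=
  inferInstanceAs (Finite (Quotient (tensorSetoid X Y)))

/-- The element `x ×_H y`. -/
def tmk (X : FinGSet (G × H)) (Y : FinGSet (H × K)) (x : X.carrier) (y : Y.carrier) :
    TensorCarrier X Y := Quotient.mk (tensorSetoid X Y) (x, y)

theorem tmk_eq_iff {X : FinGSet (G × H)} {Y : FinGSet (H × K)} {x x' : X.carrier}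
    {y y' : Y.carrier} : tmk X Y x y = tmk X Y x' y' ↔
      ∃ h : H, x' = ((1, h) : G × H) • x ∧ y' = ((h, 1) : H × K) • y := by
  refine (Quotient.eq (r := tensorSetoid X Y)).trans ?_
  change (∃ h : H, (x', y') = _) ↔ _
  simp [Prod.ext_iff]

theorem tensor_ind {X : FinGSet (G × H)} {Y : FinGSet (H × K)} {p : TensorCarrier X Y → Prop}
    (h : ∀ x y, p (tmk X Y x y)) : ∀ t, p t := by
  intro t
  induction t using Quotient.ind with
  | _ a => exact h a.1 a.2

/-- Maps out of `X ×_H Y`. -/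
def tlift {X : FinGSet (G × H)} {Y : FinGSet (H × K)} {T : Type*}
    (f : X.carrier → Y.carrier → T)
    (hf : ∀ (h : H) x y, f (((1, h) : G × H) • x) (((h, 1) : H × K) • y) = f x y) :
    TensorCarrier X Y → T :=
  Quotient.lift (fun p => f p.1 p.2) (by
    rintro ⟨a, b⟩ ⟨c, d⟩ ⟨h, hh⟩
    obtain ⟨rfl, rfl⟩ := Prod.mk.inj hh
    exact (hf h a b).symm)

@[simp] theorem tlift_tmk {X : FinGSet (G × H)} {Y : FinGSet (H × K)} {T : Type*}
    (f : X.carrier → Y.carrier → T) (hf) (x : X.carrier) (y : Y.carrier) :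
    tlift f hf (tmk X Y x y) = f x y := rfl

/-- The action `g (x ×_H y) k = (g x) ×_H (y k)`. -/
instance tensorAction (X : FinGSet (G × H)) (Y : FinGSet (H × K)) :
    MulAction (G × K) (TensorCarrier X Y) where
  smul p := tlift (fun x y => tmk X Y (((p.1, 1) : G × H) • x) (((1, p.2) : H × K) • y))
    (fun h x y => by
      refine (tmk_eq_iff.2 ⟨h, ?_, ?_⟩).symm <;> simp [smul_smul])
  one_smul := tensor_ind fun x y => by
    change tmk X Y _ _ = _
    congr 1
    · exact one_smul (G × H) x
    · exact one_smul (H × K) y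
  mul_smul p q := tensor_ind fun x y => by
    change tmk X Y _ _ = tmk X Y _ _
    simp [smul_smul]

theorem smul_tmk {X : FinGSet (G × H)} {Y : FinGSet (H × K)} (p : G × K) (x : X.carrier)
    (y : Y.carrier) : p • tmk X Y x y =
      tmk X Y (((p.1, 1) : G × H) • x) (((1, p.2) : H × K) • y) := rfl

/-- The tensor product `X ×_H Y` of bisets. -/
def tensor (X : FinGSet (G × H)) (Y : FinGSet (H × K)) : FinGSet (G × K) := ⟨TensorCarrier X Y⟩

/-- The number of `G`-orbits in `X` which are isomorphic to `G/L`, that is, which contain a point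
with stabilizer `L`. -/
def orbitCount (L : Subgroup G) (X : FinGSet G) : ℕ :=
  Set.ncard {ω : Set X.carrier | ∃ x, MulAction.stabilizer G x = L ∧ MulAction.orbit G x = ω}

/-! ### Compatibility with isomorphisms and disjoint unions -/

theorem sum_congr {X X' Y Y' : FinGSet G} : Iso X X' → Iso Y Y' → Iso (sum X Y) (sum X' Y') := by
  rintro ⟨e, he⟩ ⟨f, hf⟩
  refine ⟨Equiv.sumCongr e f, ?_⟩
  rintro g (x | x)
  · exact congrArg Sum.inl (he g x)
  · exact congrArg Sum.inr (hf g x)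

theorem prod_congr {X X' Y Y' : FinGSet G} :
    Iso X X' → Iso Y Y' → Iso (prod X Y) (prod X' Y') := by
  rintro ⟨e, he⟩ ⟨f, hf⟩
  refine ⟨Equiv.prodCongr e f, ?_⟩
  rintro g ⟨x, y⟩
  exact Prod.ext (he g x) (hf g y)

theorem sum_comm (X Y : FinGSet G) : Iso (sum X Y) (sum Y X) :=
  ⟨Equiv.sumComm _ _, by rintro g (x | x) <;> rfl⟩

theorem sum_assoc (X Y Z : FinGSet G) : Iso (sum (sum X Y) Z) (sum X (sum Y Z)) :=
  ⟨Equiv.sumAssoc _ _ _, by rintro g ((x | x) | x) <;> rfl⟩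

theorem empty_sum (X : FinGSet G) : Iso (sum (empty G) X) X :=
  ⟨Equiv.emptySum PEmpty _, by
    rintro g (x | x)
    · exact x.elim
    · rfl⟩

theorem prod_comm (X Y : FinGSet G) : Iso (prod X Y) (prod Y X) :=
  ⟨Equiv.prodComm _ _, by rintro g ⟨x, y⟩; rfl⟩

theorem prod_assoc (X Y Z : FinGSet G) : Iso (prod (prod X Y) Z) (prod X (prod Y Z)) :=
  ⟨Equiv.prodAssoc _ _ _, by rintro g ⟨⟨x, y⟩, z⟩; rfl⟩

theorem point_prod (X : FinGSet G) : Iso (prod (point G) X) X :=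
  ⟨Equiv.punitProd _, by rintro g ⟨x, y⟩; rfl⟩

theorem empty_prod (X : FinGSet G) : Iso (prod (empty G) X) (empty G) :=
  ⟨Equiv.pemptyProd _, by rintro g ⟨x, y⟩; exact x.elim⟩

theorem sum_prod (X Y Z : FinGSet G) :
    Iso (prod (sum X Y) Z) (sum (prod X Z) (prod Y Z)) :=
  ⟨Equiv.sumProdDistrib _ _ _, by rintro g ⟨x | x, y⟩ <;> rfl⟩

theorem twist_congr (φ : MulAut G) {X Y : FinGSet G} : Iso X Y → Iso (twist φ X) (twist φ Y) := by
  rintro ⟨e, he⟩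
  exact ⟨e, fun g x => he ((φ⁻¹ : MulAut G) g) x⟩

theorem twist_sum (φ : MulAut G) (X Y : FinGSet G) :
    Iso (twist φ (sum X Y)) (sum (twist φ X) (twist φ Y)) :=
  ⟨Equiv.refl _, by rintro g (x | x) <;> rfl⟩

theorem twist_prod (φ : MulAut G) (X Y : FinGSet G) :
    Iso (twist φ (prod X Y)) (prod (twist φ X) (twist φ Y)) :=
  ⟨Equiv.refl _, by rintro g ⟨x, y⟩; rfl⟩

theorem twist_point (φ : MulAut G) : Iso (twist φ (point G)) (point G) :=
  ⟨Equiv.refl _, fun _ _ => rfl⟩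

theorem twist_one (X : FinGSet G) : Iso (twist 1 X) X := ⟨Equiv.refl _, fun _ _ => rfl⟩

theorem twist_mul (φ ψ : MulAut G) (X : FinGSet G) :
    Iso (twist (φ * ψ) X) (twist φ (twist ψ X)) :=
  ⟨Equiv.refl _, fun g (x : X.carrier) => by
    change ((φ * ψ)⁻¹ : MulAut G) g • x = (ψ⁻¹ : MulAut G) ((φ⁻¹ : MulAut G) g) • x
    rw [mul_inv_rev]; rfl⟩

theorem twist_conj (a : G) (X : FinGSet G) : Iso (twist (MulAut.conj a) X) X :=
  ⟨@MulAction.toPerm G X.carrier _ _ a, fun g (x : X.carrier) => by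
    change a • ((MulAut.conj a)⁻¹ : MulAut G) g • x = g • a • x
    rw [← map_inv, MulAut.conj_apply, smul_smul, smul_smul]
    congr 1
    group⟩

theorem twist_coset [Finite G] (φ : MulAut G) (L : Subgroup G) :
    Iso (twist φ (coset L)) (coset (L.map φ.toMonoidHom)) := by
  refine ⟨Quotient.congr φ.toEquiv fun a b => ?_, fun g x => ?_⟩
  · rw [QuotientGroup.leftRel_apply, QuotientGroup.leftRel_apply]
    change _ ↔ (φ a)⁻¹ * φ b ∈ _
    rw [← map_inv, ← map_mul]
    exact (Subgroup.mem_map_iff_mem φ.injective).symm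
  · induction x using QuotientGroup.induction_on with
    | _ a =>
      change ((φ ((φ⁻¹ : MulAut G) g * a) : G) : G ⧸ L.map φ.toMonoidHom) = ((g * φ a : G) : _)
      rw [map_mul, MulAut.apply_inv_self]

theorem op_congr {X Y : FinGSet (G × H)} : Iso X Y → Iso (op X) (op Y) := by
  rintro ⟨e, he⟩
  exact ⟨e, fun g x => he (g.2, g.1) x⟩

theorem op_sum (X Y : FinGSet (G × H)) : Iso (op (sum X Y)) (sum (op X) (op Y)) :=
  ⟨Equiv.refl _, by rintro g (x | x) <;> rfl⟩

theorem op_op (X : FinGSet (G × H)) : Iso (op (op X)) X := ⟨Equiv.refl _, fun _ _ => rfl⟩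

theorem op_regular [Finite G] : Iso (op (regular G)) (regular G) :=
  ⟨Equiv.inv G, fun p (x : G) => by
    change (p.2 * x * p.1⁻¹)⁻¹ = p.1 * x⁻¹ * p.2⁻¹
    group⟩

theorem op_coset [Finite G] [Finite H] (L : Subgroup (G × H)) :
    Iso (op (coset L)) (coset (L.map (MulEquiv.prodComm : G × H ≃* H × G).toMonoidHom)) := by
  refine ⟨Quotient.congr (MulEquiv.prodComm : G × H ≃* H × G).toEquiv fun a b => ?_,
    fun g x => ?_⟩
  · rw [QuotientGroup.leftRel_apply, QuotientGroup.leftRel_apply]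
    change _ ↔ ((MulEquiv.prodComm : G × H ≃* H × G) a)⁻¹ *
      (MulEquiv.prodComm : G × H ≃* H × G) b ∈ _
    rw [← map_inv, ← map_mul]
    exact (Subgroup.mem_map_iff_mem (MulEquiv.prodComm : G × H ≃* H × G).injective).symm
  · induction x using QuotientGroup.induction_on with
    | _ a => rfl

theorem tensor_congr {X X' : FinGSet (G × H)} {Y Y' : FinGSet (H × K)} :
    Iso X X' → Iso Y Y' → Iso (tensor X Y) (tensor X' Y') := by
  rintro ⟨e, he⟩ ⟨f, hf⟩
  refine ⟨⟨tlift (fun x y => tmk X' Y' (e x) (f y)) ?_,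
    tlift (fun x y => tmk X Y (e.symm x) (f.symm y)) ?_, ?_, ?_⟩, ?_⟩
  · exact fun h x y => (tmk_eq_iff.2 ⟨h, he _ _, hf _ _⟩).symm
  · exact fun h x y => (tmk_eq_iff.2 ⟨h, by rw [Equiv.symm_apply_eq, he, e.apply_symm_apply],
      by rw [Equiv.symm_apply_eq, hf, f.apply_symm_apply]⟩).symm
  · refine tensor_ind fun x y => ?_
    change tmk X Y (e.symm (e x)) (f.symm (f y)) = _
    rw [e.symm_apply_apply, f.symm_apply_apply]
  · refine tensor_ind fun x y => ?_
    change tmk X' Y' (e (e.symm x)) (f (f.symm y)) = _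
    rw [e.apply_symm_apply, f.apply_symm_apply]
  · intro p
    refine tensor_ind fun x y => ?_
    change tmk X' Y' (e _) (f _) = tmk X' Y' _ _
    rw [he, hf]

theorem op_tensor (X : FinGSet (G × H)) (Y : FinGSet (H × K)) :
    Iso (op (tensor X Y)) (tensor (op Y) (op X)) := by
  refine ⟨⟨tlift (fun x y => tmk (op Y) (op X) y x) ?_,
    tlift (X := op Y) (Y := op X) (fun y x => tmk X Y x y) ?_, ?_, ?_⟩, ?_⟩
  · intro h x y
    refine tmk_eq_iff.2 ⟨h⁻¹, ?_, ?_⟩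
    · change y = ((h⁻¹, 1) : H × K) • ((h, 1) : H × K) • y
      simp [smul_smul, ← Prod.one_eq_mk]
    · change x = ((1, h⁻¹) : G × H) • ((1, h) : G × H) • x
      simp [smul_smul, ← Prod.one_eq_mk]
  · intro h (y : Y.carrier) (x : X.carrier)
    refine tmk_eq_iff.2 ⟨h⁻¹, ?_, ?_⟩
    · change x = ((1, h⁻¹) : G × H) • ((1, h) : G × H) • x
      simp [smul_smul, ← Prod.one_eq_mk]
    · change y = ((h⁻¹, 1) : H × K) • ((h, 1) : H × K) • y
      simp [smul_smul, ← Prod.one_eq_mk]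
  · exact tensor_ind fun x y => rfl
  · exact tensor_ind fun x y => rfl
  · intro p
    exact tensor_ind fun x y => rfl

theorem sum_tensor (X X' : FinGSet (G × H)) (Y : FinGSet (H × K)) :
    Iso (tensor (sum X X') Y) (sum (tensor X Y) (tensor X' Y)) := by
  refine ⟨⟨tlift (X := sum X X') (fun x y => Sum.elim (fun x => Sum.inl (tmk X Y x y))
      (fun x => Sum.inr (tmk X' Y x y)) x) ?_,
    Sum.elim (tlift (fun x y => tmk (sum X X') Y (Sum.inl x) y) ?_)
      (tlift (fun x y => tmk (sum X X') Y (Sum.inr x) y) ?_), ?_, ?_⟩, ?_⟩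
  · rintro h (x | x) y
    · exact congrArg Sum.inl (tmk_eq_iff.2 ⟨h, rfl, rfl⟩).symm
    · exact congrArg Sum.inr (tmk_eq_iff.2 ⟨h, rfl, rfl⟩).symm
  · exact fun h x y => (tmk_eq_iff (X := sum X X') (x := Sum.inl x) (y := y).2
      ⟨h, rfl, rfl⟩).symm
  · exact fun h x y => (tmk_eq_iff (X := sum X X') (x := Sum.inr x) (y := y).2
      ⟨h, rfl, rfl⟩).symm
  · refine tensor_ind ?_
    rintro (x | x) y <;> rfl
  · rintro (t | t)
    · exact tensor_ind (p := fun t => tlift _ _ (Sum.elim _ _ (Sum.inl t)) = Sum.inl t)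
        (fun x y => rfl) t
    · exact tensor_ind (p := fun t => tlift _ _ (Sum.elim _ _ (Sum.inr t)) = Sum.inr t)
        (fun x y => rfl) t
  · intro p
    refine tensor_ind ?_
    rintro (x | x) y <;> rfl

theorem tensor_sum (X : FinGSet (G × H)) (Y Y' : FinGSet (H × K)) :
    Iso (tensor X (sum Y Y')) (sum (tensor X Y) (tensor X Y')) := by
  refine (op_op _).symm.trans ((op_congr ?_).trans (op_op _))
  refine (op_tensor _ _).trans ((tensor_congr (op_sum _ _) (Iso.refl _)).trans ?_)
  refine (sum_tensor _ _ _).trans (Iso.trans ?_ (op_sum _ _).symm)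
  exact sum_congr (op_tensor _ _).symm (op_tensor _ _).symm

theorem tensor_assoc {M : Type u} [Group M] (X : FinGSet (G × H)) (Y : FinGSet (H × K))
    (Z : FinGSet (K × M)) :
    Iso (tensor (tensor X Y) Z) (tensor X (tensor Y Z)) := by
  refine ⟨⟨tlift (X := tensor X Y) (fun t z => tlift (fun x y =>
      tmk X (tensor Y Z) x (tmk Y Z y z)) ?_ t) ?_,
    tlift (Y := tensor Y Z) (fun x t => tlift (fun y z =>
      tmk (tensor X Y) Z (tmk X Y x y) z) ?_ t) ?_, ?_, ?_⟩, ?_⟩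
  · intro h x y
    refine (tmk_eq_iff.2 ⟨h, rfl, ?_⟩).symm
    change _ = tmk Y Z _ (((1, 1) : K × M) • z)
    rw [← Prod.one_eq_mk, one_smul]
  · intro k t z
    refine tensor_ind (p := fun t => tlift _ _ (((1, k) : G × K) • t) = tlift _ _ t)
      (fun x y => ?_) t
    change tmk X (tensor Y Z) (((1, 1) : G × H) • x) _ = tmk X (tensor Y Z) x _
    rw [← Prod.one_eq_mk, one_smul]
    exact congrArg _ (tmk_eq_iff.2 ⟨k, rfl, rfl⟩).symm
  · intro k y z
    refine (tmk_eq_iff.2 ⟨k, ?_, rfl⟩).symm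
    change _ = tmk X Y (((1, 1) : G × H) • x) _
    rw [← Prod.one_eq_mk, one_smul]
  · intro h x t
    refine tensor_ind (p := fun t => tlift _ _ (((h, 1) : H × M) • t) = tlift _ _ t)
      (fun y z => ?_) t
    change tmk (tensor X Y) Z _ (((1, 1) : K × M) • z) = tmk (tensor X Y) Z _ z
    rw [← Prod.one_eq_mk, one_smul]
    exact congrArg (fun s => tmk (tensor X Y) Z s z) (tmk_eq_iff.2 ⟨h, rfl, rfl⟩).symm
  · refine tensor_ind fun t z => ?_
    exact tensor_ind (p := fun t => tlift _ _ (tlift _ _ (tmk (tensor X Y) Z t z)) =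
      tmk (tensor X Y) Z t z) (fun x y => rfl) t
  · refine tensor_ind fun x t => ?_
    exact tensor_ind (p := fun t => tlift _ _ (tlift _ _ (tmk X (tensor Y Z) x t)) =
      tmk X (tensor Y Z) x t) (fun x y => rfl) t
  · intro p
    refine tensor_ind fun t z => ?_
    induction t using tensor_ind with
    | _ x y =>
      change tmk X (tensor Y Z) (((p.1, 1) : G × H) • x)
          (tmk Y Z (((1, 1) : H × K) • y) (((1, p.2) : K × M) • z)) =
        tmk X (tensor Y Z) (((p.1, 1) : G × H) • x)
          (tmk Y Z (((1, 1) : H × K) • y) (((1, p.2) : K × M) • z))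
      rfl

theorem regular_tensor [Finite G] (X : FinGSet (G × H)) : Iso (tensor (regular G) X) X := by
  refine ⟨⟨tlift (X := regular G) (fun (g : G) x => ((g, 1) : G × H) • x) ?_,
    fun x => tmk (regular G) X (1 : G) x, ?_, ?_⟩, ?_⟩
  · intro h (g : G) x
    change (((1 * g * h⁻¹ : G), 1) : G × H) • ((h, 1) : G × H) • x = _
    simp [smul_smul]
  · refine tensor_ind fun (g : G) x => ?_
    refine tmk_eq_iff.2 ⟨g⁻¹, ?_, ?_⟩
    · change g = (1 * (1 : G) * g⁻¹⁻¹ : G)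
      simp
    · change x = ((g⁻¹, 1) : G × H) • ((g, 1) : G × H) • x
      simp [smul_smul, ← Prod.one_eq_mk]
  · intro x
    exact one_smul (G × H) x
  · intro p
    refine tensor_ind fun (g : G) x => ?_
    change (((p.1 * g * 1⁻¹ : G), 1) : G × H) • ((1, p.2) : G × H) • x =
      p • ((g, 1) : G × H) • x
    simp [smul_smul, Prod.mul_def]

theorem tensor_regular [Finite H] (X : FinGSet (G × H)) : Iso (tensor X (regular H)) X :=
  (op_op _).symm.trans ((op_congr ((op_tensor _ _).trans
    ((tensor_congr op_regular (Iso.refl _)).trans (regular_tensor _)))).trans (op_op _))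

theorem IsBifree.op {X : FinGSet (G × H)} (hX : X.IsBifree) : (op X).IsBifree :=
  ⟨fun g x => hX.2 g x, fun g x => hX.1 g x⟩

theorem IsBifree.tensor {X : FinGSet (G × H)} {Y : FinGSet (H × K)} (hX : X.IsBifree)
    (hY : Y.IsBifree) : (tensor X Y).IsBifree := by
  constructor
  · intro g
    refine tensor_ind fun x y hxy => ?_
    obtain ⟨h, h1, h2⟩ := tmk_eq_iff.1 hxy
    have hh : h = 1 := by
      refine hY.1 h y ?_
      have h3 : y = ((h, 1) : H × K) • (1 : H × K) • y := h2
      rw [one_smul] at h3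
      exact h3.symm
    subst hh
    refine hX.1 g x ?_
    have h3 : x = (1 : G × H) • ((g, 1) : G × H) • x := h1
    rw [one_smul] at h3
    exact h3.symm
  · intro k
    refine tensor_ind fun x y hxy => ?_
    obtain ⟨h, h1, h2⟩ := tmk_eq_iff.1 hxy
    have hh : h = 1 := by
      refine hX.2 h x ?_
      have h3 : x = ((1, h) : G × H) • (1 : G × H) • x := h1
      rw [one_smul] at h3
      exact h3.symm
    subst hh
    refine hY.2 k y ?_
    have h3 : y = (1 : H × K) • ((1, k) : H × K) • y := h2
    rw [one_smul] at h3
    exact h3.symm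

theorem isBifree_regular [Finite G] : (regular G).IsBifree := by
  constructor
  · intro g (x : G) h
    have h' : g * x * 1⁻¹ = x := h
    simpa using h'
  · intro g (x : G) h
    have h' : 1 * x * g⁻¹ = x := h
    simpa using h'

theorem orbitCount_congr (L : Subgroup G) {X Y : FinGSet G} :
    Iso X Y → orbitCount L X = orbitCount L Y := by
  rintro ⟨e, he⟩
  unfold orbitCount
  rw [← Set.ncard_image_of_injective _ (Set.image_injective.2 e.injective)]
  have hs : ∀ x, MulAction.stabilizer G (e x) = MulAction.stabilizer G x := fun x => by
    ext g
    rw [MulAction.mem_stabilizer_iff, MulAction.mem_stabilizer_iff, ← he, e.injective.eq_iff]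
  have ho : ∀ x, MulAction.orbit G (e x) = e '' MulAction.orbit G x := fun x => by
    change Set.range _ = _ '' Set.range _
    rw [← Set.range_comp]
    exact congrArg Set.range (funext fun g => (he g x).symm)
  congr 1
  ext ω
  constructor
  · rintro ⟨_, ⟨x, hx, rfl⟩, rfl⟩
    exact ⟨e x, (hs x).trans hx, ho x⟩
  · rintro ⟨y, hy, rfl⟩
    obtain ⟨x, rfl⟩ := e.surjective y
    exact ⟨_, ⟨x, (hs x).symm.trans hy, rfl⟩, (ho x).symm⟩

theorem orbitCount_sum (L : Subgroup G) (X Y : FinGSet G) :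
    orbitCount L (sum X Y) = orbitCount L X + orbitCount L Y := by
  have hl : ∀ x : X.carrier, MulAction.stabilizer G (α := (sum X Y).carrier) (Sum.inl x) =
      MulAction.stabilizer G x := fun x => by
    ext g
    exact Sum.inl_injective.eq_iff (a := g • x) (b := x)
  have hr : ∀ y : Y.carrier, MulAction.stabilizer G (α := (sum X Y).carrier) (Sum.inr y) =
      MulAction.stabilizer G y := fun y => by
    ext g
    exact Sum.inr_injective.eq_iff (a := g • y) (b := y)
  have hol : ∀ x : X.carrier, MulAction.orbit G (α := (sum X Y).carrier) (Sum.inl x) =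
      Sum.inl '' MulAction.orbit G x := fun x => by
    exact Set.range_comp _ _
  have hor : ∀ y : Y.carrier, MulAction.orbit G (α := (sum X Y).carrier) (Sum.inr y) =
      Sum.inr '' MulAction.orbit G y := fun y => by
    exact Set.range_comp _ _
  unfold orbitCount
  rw [← Set.ncard_image_of_injective {ω : Set X.carrier | _}
      (Set.image_injective.2 (Sum.inl_injective (α := X.carrier) (β := Y.carrier))),
    ← Set.ncard_image_of_injective {ω : Set Y.carrier | _}
      (Set.image_injective.2 (Sum.inr_injective (α := X.carrier) (β := Y.carrier))),
    ← Set.ncard_union_eq]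
  · congr 1
    ext ω
    constructor
    · rintro ⟨x | y, h, rfl⟩
      · exact Or.inl ⟨_, ⟨x, (hl x).symm.trans h, rfl⟩, (hol x).symm⟩
      · exact Or.inr ⟨_, ⟨y, (hr y).symm.trans h, rfl⟩, (hor y).symm⟩
    · rintro (⟨_, ⟨x, h, rfl⟩, rfl⟩ | ⟨_, ⟨y, h, rfl⟩, rfl⟩)
      · exact ⟨Sum.inl x, (hl x).trans h, hol x⟩
      · exact ⟨Sum.inr y, (hr y).trans h, hor y⟩
  · rw [Set.disjoint_left]
    rintro _ ⟨_, ⟨x, h, rfl⟩, rfl⟩ ⟨_, ⟨y, h', rfl⟩, he⟩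
    have h1 : (Sum.inl x : X.carrier ⊕ Y.carrier) ∈ Sum.inr '' MulAction.orbit G y := by
      rw [he]; exact ⟨x, MulAction.mem_orbit_self x, rfl⟩
    obtain ⟨z, _, hz⟩ := h1
    cases hz

end FinGSet

open FinGSet

/-- Isomorphism classes of finite `G`-sets. -/
def GSetClass (G : Type u) [Group G] : Type (u + 1) := Quotient (FinGSet.setoid G)

namespace GSetClass

variable {G H K : Type u} [Group G] [Group H] [Group K]

/-- The isomorphism class of `X`. -/
def mk (X : FinGSet G) : GSetClass G := Quotient.mk _ X

theorem sound {X Y : FinGSet G} (h : Iso X Y) : mk X = mk Y := Quotient.sound h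

theorem mk_eq_iff {X Y : FinGSet G} : mk X = mk Y ↔ Iso X Y := Quotient.eq

theorem ind {p : GSetClass G → Prop} (h : ∀ X, p (mk X)) : ∀ x, p x := Quotient.ind h

/-- Isomorphism classes form a commutative semiring under disjoint union and direct product. -/
instance : CommSemiring (GSetClass G) where
  add := Quotient.map₂ sum fun _ _ h _ _ h' => sum_congr h h'
  zero := mk (empty G)
  mul := Quotient.map₂ prod fun _ _ h _ _ h' => prod_congr h h'
  one := mk (point G)
  add_assoc := ind fun X => ind fun Y => ind fun Z => sound (sum_assoc X Y Z)
  zero_add := ind fun X => sound (empty_sum X)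
  add_zero := ind fun X => sound ((sum_comm _ _).trans (empty_sum X))
  add_comm := ind fun X => ind fun Y => sound (sum_comm X Y)
  nsmul := letI : Zero (GSetClass G) := ⟨mk (empty G)⟩
    letI : Add (GSetClass G) :=
      ⟨Quotient.map₂ sum fun _ _ h _ _ h' => sum_congr h h'⟩
    nsmulRec
  nsmul_zero _ := rfl
  nsmul_succ _ _ := rfl
  mul_assoc := ind fun X => ind fun Y => ind fun Z => sound (prod_assoc X Y Z)
  one_mul := ind fun X => sound (point_prod X)
  mul_one := ind fun X => sound ((prod_comm _ _).trans (point_prod X))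
  zero_mul := ind fun X => sound (empty_prod X)
  mul_zero := ind fun X => sound ((prod_comm _ _).trans (empty_prod X))
  mul_comm := ind fun X => ind fun Y => sound (prod_comm X Y)
  right_distrib := ind fun X => ind fun Y => ind fun Z => sound (sum_prod X Y Z)
  left_distrib := ind fun X => ind fun Y => ind fun Z => sound
    ((prod_comm _ _).trans ((sum_prod Y Z X).trans (sum_congr (prod_comm _ _) (prod_comm _ _))))

theorem mk_add (X Y : FinGSet G) : mk X + mk Y = mk (sum X Y) := rfl
theorem mk_mul (X Y : FinGSet G) : mk X * mk Y = mk (prod X Y) := rfl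

end GSetClass

/-! ## The Burnside ring -/

/-- The Burnside ring `B(G)`: the Grothendieck group of finite `G`-sets under disjoint union. -/
def Burnside (G : Type u) [Group G] : Type (u + 1) := Algebra.GrothendieckAddGroup (GSetClass G)

namespace Burnside

variable {G H K : Type u} [Group G] [Group H] [Group K]

instance : AddCommGroup (Burnside G) :=
  inferInstanceAs (AddCommGroup (Algebra.GrothendieckAddGroup (GSetClass G)))

/-- The canonical map from isomorphism classes to `B(G)`. -/
def of : GSetClass G →+ Burnside G := Algebra.GrothendieckAddGroup.of

/-- The element `[X]` of `B(G)`. -/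
def cls (X : FinGSet G) : Burnside G := of (GSetClass.mk X)

/-- The extension of an additive map on isomorphism classes to `B(G)`. -/
def lift {A : Type*} [AddCommGroup A] (f : GSetClass G →+ A) : Burnside G →+ A :=
  Algebra.GrothendieckAddGroup.lift f

@[simp] theorem lift_of {A : Type*} [AddCommGroup A] (f : GSetClass G →+ A) (x : GSetClass G) :
    lift f (of x) = f x :=
  DFunLike.congr_fun (Algebra.GrothendieckAddGroup.lift.symm_apply_apply f) x

@[simp] theorem lift_cls {A : Type*} [AddCommGroup A] (f : GSetClass G →+ A) (X : FinGSet G) :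
    lift f (cls X) = f (GSetClass.mk X) := lift_of f _

theorem cls_eq {X Y : FinGSet G} (h : Iso X Y) : cls X = cls Y :=
  congrArg of (GSetClass.sound h)

theorem cls_add (X Y : FinGSet G) : cls X + cls Y = cls (sum X Y) :=
  (map_add of _ _).symm

theorem cls_empty : cls (empty G) = 0 := map_zero of

theorem exists_sub' {M : Type*} [AddCommMonoid M] (a : Algebra.GrothendieckAddGroup M) :
    ∃ x y : M, a = Algebra.GrothendieckAddGroup.of x - Algebra.GrothendieckAddGroup.of y := by
  induction a using AddLocalization.ind with
  | _ p =>
    obtain ⟨x, y, hy⟩ := p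
    refine ⟨x, y, ?_⟩
    rw [eq_sub_iff_add_eq]
    change AddLocalization.mk x ⟨y, hy⟩ + AddLocalization.mk y 0 = AddLocalization.mk x 0
    rw [AddLocalization.mk_add, AddLocalization.mk_eq_mk_iff, AddLocalization.r_iff_exists]
    refine ⟨0, ?_⟩
    simp [add_comm]

theorem exists_sub (a : Burnside G) : ∃ X Y : FinGSet G, a = cls X - cls Y := by
  obtain ⟨x, y, rfl⟩ := exists_sub' a
  induction x using GSetClass.ind with
  | _ X =>
    induction y using GSetClass.ind with
    | _ Y => exact ⟨X, Y, rfl⟩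

theorem induction {p : Burnside G → Prop} (h₁ : ∀ X, p (cls X))
    (h₂ : ∀ a b, p a → p b → p (a - b)) : ∀ a, p a := by
  intro a
  obtain ⟨X, Y, rfl⟩ := exists_sub a
  exact h₂ _ _ (h₁ X) (h₁ Y)

/-- The biadditive extension to Burnside groups of a biadditive operation on finite sets. -/
def lift₂ {A : Type*} [AddCommGroup A] (f : GSetClass G →+ GSetClass H →+ A) :
    Burnside G →+ Burnside H →+ A :=
  lift
    { toFun := fun x => lift (f x)
      map_zero' := by
        ext a
        induction a using Burnside.induction with
        | h₁ X => simp
        | h₂ a b ha hb => rw [map_sub, ha, hb]; simp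
      map_add' := fun x y => by
        ext a
        induction a using Burnside.induction with
        | h₁ X => simp
        | h₂ a b ha hb => rw [map_sub, ha, hb, map_sub] }

@[simp] theorem lift₂_cls {A : Type*} [AddCommGroup A] (f : GSetClass G →+ GSetClass H →+ A)
    (X : FinGSet G) (Y : FinGSet H) :
    lift₂ f (cls X) (cls Y) = f (GSetClass.mk X) (GSetClass.mk Y) := by
  simp [lift₂]

/-- The multiplication of `B(G)`, determined by `[X] [Y] = [X × Y]`. -/
def mulHom : Burnside G →+ Burnside G →+ Burnside G :=
  lift₂ ((AddMonoidHom.compHom of).comp AddMonoidHom.mul)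

instance : Mul (Burnside G) := ⟨fun a b => mulHom a b⟩
instance : One (Burnside G) := ⟨cls (point G)⟩

theorem mul_def (a b : Burnside G) : a * b = mulHom a b := rfl

theorem cls_mul (X Y : FinGSet G) : cls X * cls Y = cls (prod X Y) := by
  rw [mul_def, mulHom, lift₂_cls]; rfl

theorem one_def : (1 : Burnside G) = cls (point G) := rfl

theorem mul_sub' (a b c : Burnside G) : a * (b - c) = a * b - a * c := map_sub _ _ _
theorem sub_mul' (a b c : Burnside G) : (a - b) * c = a * c - b * c := by
  simp [mul_def]

theorem mul_comm' (a b : Burnside G) : a * b = b * a := by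
  induction a using Burnside.induction with
  | h₂ a b ha hb => rw [sub_mul', ha, hb, mul_sub']
  | h₁ X =>
    induction b using Burnside.induction with
    | h₂ a b ha hb => rw [mul_sub', ha, hb, sub_mul']
    | h₁ Y => rw [cls_mul, cls_mul]; exact cls_eq (prod_comm X Y)

theorem mul_assoc' (a b c : Burnside G) : a * b * c = a * (b * c) := by
  induction a using Burnside.induction with
  | h₂ a b ha hb => rw [sub_mul', sub_mul', ha, hb, sub_mul']
  | h₁ X =>
    induction b using Burnside.induction with
    | h₂ a b ha hb => rw [mul_sub', sub_mul', ha, hb, sub_mul', mul_sub']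
    | h₁ Y =>
      induction c using Burnside.induction with
      | h₂ a b ha hb => rw [mul_sub', ha, hb, mul_sub', mul_sub']
      | h₁ Z => simp only [cls_mul]; exact cls_eq (prod_assoc X Y Z)

theorem one_mul' (a : Burnside G) : 1 * a = a := by
  induction a using Burnside.induction with
  | h₂ a b ha hb => rw [mul_sub', ha, hb]
  | h₁ X => rw [one_def, cls_mul]; exact cls_eq (point_prod X)

/-- `B(G)` is a commutative ring with `[X] + [Y] = [X ⊔ Y]` and `[X] [Y] = [X × Y]`. -/
instance : CommRing (Burnside G) where
  left_distrib a b c := map_add _ _ _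
  right_distrib a b c := by simp [mul_def]
  zero_mul a := by simp [mul_def]
  mul_zero a := by simp [mul_def]
  mul_assoc := mul_assoc'
  one_mul := one_mul'
  mul_one a := by rw [mul_comm', one_mul']
  mul_comm := mul_comm'
  neg_add_cancel := neg_add_cancel
  zsmul := (· • ·)
  zsmul_zero' := SubNegMonoid.zsmul_zero'
  zsmul_succ' := SubNegMonoid.zsmul_succ'
  zsmul_neg' := SubNegMonoid.zsmul_neg'
  sub_eq_add_neg := sub_eq_add_neg

/-- An additive map into a group preserves `0`. -/
def ofAdd {M A : Type*} [AddCommMonoid M] [AddCommGroup A] (f : M → A)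
    (h : ∀ x y, f (x + y) = f x + f y) : M →+ A where
  toFun := f
  map_zero' := by simpa using h 0 0
  map_add' := h

/-- The additive map `B(G) → B(H)` with `[X] ↦ [F X]`, for an operation `F` on finite sets that
respects isomorphisms and disjoint unions. -/
def map (F : FinGSet G → FinGSet H) (h₁ : ∀ X Y, Iso X Y → Iso (F X) (F Y))
    (h₂ : ∀ X Y, Iso (F (sum X Y)) (sum (F X) (F Y))) : Burnside G →+ Burnside H :=
  lift (ofAdd (fun x => of (Quotient.map F h₁ x)) (GSetClass.ind fun X => GSetClass.ind fun Y =>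
    (cls_eq (h₂ X Y)).trans (cls_add _ _).symm))

theorem map_cls (F : FinGSet G → FinGSet H) (h₁) (h₂) (X : FinGSet G) :
    map F h₁ h₂ (cls X) = cls (F X) := by
  rw [map, lift_cls]; rfl

/-- The biadditive map `B(G) × B(H) → B(K)` with `([X], [Y]) ↦ [F X Y]`. -/
def map₂ (F : FinGSet G → FinGSet H → FinGSet K)
    (h₁ : ∀ X X', Iso X X' → ∀ Y Y', Iso Y Y' → Iso (F X Y) (F X' Y'))
    (h₂ : ∀ X X' Y, Iso (F (sum X X') Y) (sum (F X Y) (F X' Y)))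
    (h₂' : ∀ X Y Y', Iso (F X (sum Y Y')) (sum (F X Y) (F X Y'))) :
    Burnside G →+ Burnside H →+ Burnside K :=
  lift₂ <| ofAdd
    (fun x => ofAdd (fun y => of (Quotient.map₂ F (fun X X' h Y Y' h' => h₁ X X' h Y Y' h') x y))
      (by
        induction x using GSetClass.ind with
        | _ X =>
          exact GSetClass.ind fun Y => GSetClass.ind fun Y' =>
            (cls_eq (h₂' X Y Y')).trans (cls_add _ _).symm))
    (GSetClass.ind fun X => GSetClass.ind fun X' => AddMonoidHom.ext <| GSetClass.ind fun Y =>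
      (cls_eq (h₂ X X' Y)).trans (cls_add _ _).symm)

theorem map₂_cls (F : FinGSet G → FinGSet H → FinGSet K) (h₁) (h₂) (h₂') (X : FinGSet G)
    (Y : FinGSet H) : map₂ F h₁ h₂ h₂' (cls X) (cls Y) = cls (F X Y) := by
  rw [map₂, lift₂_cls]; rfl

/-- The coefficient of the standard basis element `[G/L]` in an element of `B(G)`: the additive map
sending `[X]` to the number of orbits of `X` isomorphic to `G/L`. -/
def coeff (L : Subgroup G) : Burnside G →+ ℤ :=
  lift (ofAdd (Quotient.lift (fun X => (orbitCount L X : ℤ))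
      fun _ _ h => congrArg Nat.cast (orbitCount_congr L h))
    (GSetClass.ind fun X => GSetClass.ind fun Y => by
      change ((orbitCount L (sum X Y) : ℕ) : ℤ) = orbitCount L X + orbitCount L Y
      rw [orbitCount_sum]; push_cast; rfl))

theorem coeff_cls (L : Subgroup G) (X : FinGSet G) : coeff L (cls X) = orbitCount L X := by
  rw [coeff, lift_cls]; rfl

/-- `[G/M]` has coefficient `1` at `[G/L]` if `L` and `M` are conjugate, and `0` otherwise. -/
theorem coeff_coset [Finite G] (L M : Subgroup G) [Decidable (∃ g : G,
    M.map (MulAut.conj g).toMonoidHom = L)] :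
    coeff L (cls (coset M)) = if ∃ g : G, M.map (MulAut.conj g).toMonoidHom = L then 1 else 0 := by
  rw [coeff_cls]
  have hst : ∀ g : G, MulAction.stabilizer G (g : G ⧸ M) = M.map (MulAut.conj g).toMonoidHom := by
    intro g
    have h1 : ((g : G) : G ⧸ M) = g • ((1 : G) : G ⧸ M) := by
      rw [MulAction.Quotient.smul_coe, smul_eq_mul, mul_one]
    rw [h1, MulAction.stabilizer_smul_eq_stabilizer_map_conj, MulAction.stabilizer_quotient]
  have hset : {ω : Set (coset M).carrier | ∃ x, MulAction.stabilizer G x = L ∧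
      MulAction.orbit G x = ω} =
      {ω | (∃ g : G, M.map (MulAut.conj g).toMonoidHom = L) ∧ ω = Set.univ} := by
    ext ω
    constructor
    · rintro ⟨x, hx, rfl⟩
      induction x using QuotientGroup.induction_on with
      | _ g => exact ⟨⟨g, (hst g).symm.trans hx⟩, MulAction.orbit_eq_univ G (α := G ⧸ M) _⟩
    · rintro ⟨⟨g, hg⟩, rfl⟩
      exact ⟨(g : G ⧸ M), (hst g).trans hg, MulAction.orbit_eq_univ G (α := G ⧸ M) _⟩
  unfold orbitCount
  rw [hset]
  split_ifs with h
  · simp only [h, true_and, Set.ofPred_eq_eq_singleton, Set.ncard_singleton, Nat.cast_one]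
  · simp only [h, false_and, Set.ofPred_false, Set.ncard_empty, Nat.cast_zero]

/-- The elements `[G/L]` span `B(G)`. -/
theorem closure_coset [Finite G] :
    AddSubgroup.closure (Set.range fun L : Subgroup G => cls (coset L)) = ⊤ := by
  have key : ∀ n : ℕ, ∀ X : FinGSet G, Nat.card X.carrier = n →
      cls X ∈ AddSubgroup.closure (Set.range fun L : Subgroup G => cls (coset L)) := by
    intro n
    induction n using Nat.strong_induction_on with
    | _ n ih =>
      intro X hX
      rcases isEmpty_or_nonempty X.carrier with he | ⟨⟨x⟩⟩
      · rw [show cls X = cls (empty G) from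
          cls_eq ⟨Equiv.equivOfIsEmpty _ PEmpty, fun _ x => he.elim x⟩, cls_empty]
        exact zero_mem _
      · let C : SubMulAction G X.carrier :=
          { carrier := (MulAction.orbit G x)ᶜ
            smul_mem' := fun g y hy h => hy (by simpa using MulAction.mem_orbit_of_mem_orbit g⁻¹ h) }
        have hC : Nat.card C < n := by
          rw [← hX]
          exact Finite.card_subtype_lt (x := x) (fun h => h (MulAction.mem_orbit_self x))
        let Y : FinGSet G := ⟨C⟩
        have hiso : Iso X (sum (coset (MulAction.stabilizer G x)) Y) := by
          classical
          refine Iso.symm ⟨((Equiv.sumCongr (MulAction.orbitEquivQuotientStabilizer G x).symm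
            (Equiv.refl _)).trans (Equiv.Set.sumCompl (MulAction.orbit G x))), ?_⟩
          rintro g (y | y)
          · induction y using QuotientGroup.induction_on with
            | _ a => exact mul_smul g a x
          · rfl
        rw [cls_eq hiso, ← cls_add]
        exact add_mem (AddSubgroup.subset_closure ⟨_, rfl⟩) (ih _ hC Y rfl)
  rw [eq_top_iff]
  rintro a -
  induction a using Burnside.induction with
  | h₁ X => exact key _ X rfl
  | h₂ a b ha hb => exact sub_mem ha hb

/-! ## The action of `Out(G)` on `B(G)ˣ` -/

/-- The additive automorphism `[X] ↦ [X twisted by φ]` of `B(G)`; it sends `[G/R]` to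
`[G/φ(R)]`. -/
def twistHom (φ : MulAut G) : Burnside G →+ Burnside G :=
  map (twist φ) (fun _ _ => twist_congr φ) (twist_sum φ)

theorem twistHom_cls (φ : MulAut G) (X : FinGSet G) :
    twistHom φ (cls X) = cls (twist φ X) := map_cls _ _ _ _

theorem twistHom_coset [Finite G] (φ : MulAut G) (R : Subgroup G) :
    twistHom φ (cls (coset R)) = cls (coset (R.map φ.toMonoidHom)) :=
  (twistHom_cls _ _).trans (cls_eq (twist_coset φ R))

theorem twistHom_one_apply (a : Burnside G) : twistHom 1 a = a := by
  induction a using Burnside.induction with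
  | h₁ X => exact (twistHom_cls _ _).trans (cls_eq (twist_one X))
  | h₂ a b ha hb => rw [map_sub, ha, hb]

theorem twistHom_mul_apply (φ ψ : MulAut G) (a : Burnside G) :
    twistHom (φ * ψ) a = twistHom φ (twistHom ψ a) := by
  induction a using Burnside.induction with
  | h₁ X => simp only [twistHom_cls]; exact cls_eq (twist_mul φ ψ X)
  | h₂ a b ha hb => simp only [map_sub, ha, hb]

theorem twistHom_conj_apply (g : G) (a : Burnside G) : twistHom (MulAut.conj g) a = a := by
  induction a using Burnside.induction with
  | h₁ X => exact (twistHom_cls _ _).trans (cls_eq (twist_conj g X))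
  | h₂ a b ha hb => rw [map_sub, ha, hb]

theorem twistHom_map_one (φ : MulAut G) : twistHom φ (1 : Burnside G) = 1 :=
  (twistHom_cls _ _).trans (cls_eq (twist_point φ))

theorem twistHom_map_mul (φ : MulAut G) (a b : Burnside G) :
    twistHom φ (a * b) = twistHom φ a * twistHom φ b := by
  induction a using Burnside.induction with
  | h₂ a a' ha hb => simp only [map_sub, sub_mul, ha, hb]
  | h₁ X =>
    induction b using Burnside.induction with
    | h₂ a a' ha hb => simp only [map_sub, mul_sub, ha, hb]
    | h₁ Y => simp only [twistHom_cls, cls_mul]; exact cls_eq (twist_prod φ X Y)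

/-- The automorphism of the ring `B(G)` with `[G/R] ↦ [G/φ(R)]`. -/
def autRingEquiv (φ : MulAut G) : Burnside G ≃+* Burnside G where
  toFun := twistHom φ
  invFun := twistHom φ⁻¹
  left_inv a := by rw [← twistHom_mul_apply, inv_mul_cancel, twistHom_one_apply]
  right_inv a := by rw [← twistHom_mul_apply, mul_inv_cancel, twistHom_one_apply]
  map_add' := map_add _
  map_mul' := twistHom_map_mul φ

/-- The action of `Aut(G)` on `B(G)ˣ`. -/
def autUnits : MulAut G →* MulAut (Burnside G)ˣ where
  toFun φ := Units.mapEquiv (autRingEquiv φ).toMulEquiv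
  map_one' := by ext u; exact twistHom_one_apply _
  map_mul' φ ψ := by ext u; exact twistHom_mul_apply φ ψ _

end Burnside

open Burnside

section Out

variable (G : Type u) [Group G]

/-- The subgroup of inner automorphisms. -/
abbrev Inn : Subgroup (MulAut G) := (MulAut.conj : G →* MulAut G).range

instance : (Inn G).Normal where
  conj_mem := by
    rintro _ ⟨g, rfl⟩ φ
    refine ⟨φ g, ?_⟩
    ext x
    simp [MulAut.conj_apply]

/-- The outer automorphism group `Out(G) = Aut(G)/Inn(G)`. -/
abbrev Out : Type u := MulAut G ⧸ Inn G

/-- The natural action of `Out(G)` on `B(G)ˣ`, induced by `[G/R] ↦ [G/φ(R)]`. -/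
def outUnits : Out G →* MulAut (Burnside G)ˣ :=
  QuotientGroup.lift (Inn G) autUnits (by
    rintro _ ⟨g, rfl⟩
    ext u
    exact twistHom_conj_apply g _)

end Out

/-! ## Double Burnside groups -/

/-- The double Burnside group `B(G, H)`, identified with `B(G × H)`. -/
abbrev DoubleBurnside (G H : Type u) [Group G] [Group H] : Type (u + 1) := Burnside (G × H)

namespace DoubleBurnside

variable {G H K M : Type u} [Group G] [Group H] [Group K] [Group M]

/-- The map `γ ↦ γ°`, determined by `[X] ↦ [X°]`. -/
def op : DoubleBurnside G H →+ DoubleBurnside H G :=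
  Burnside.map FinGSet.op (fun _ _ => op_congr) op_sum

/-- The biadditive map `(γ, δ) ↦ γ ·_H δ`, determined by `([X], [Y]) ↦ [X ×_H Y]`. -/
def tensor : DoubleBurnside G H →+ DoubleBurnside H K →+ DoubleBurnside G K :=
  Burnside.map₂ FinGSet.tensor (fun _ _ h _ _ h' => tensor_congr h h') sum_tensor tensor_sum

/-- The element `[G]` of `B(G, G)`. -/
def unit (G : Type u) [Group G] [Finite G] : DoubleBurnside G G := cls (regular G)

/-- The bifree double Burnside group `B^Δ(G, H)`: the subgroup of `B(G, H)` generated by the classes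
of bifree bisets. -/
def bifree (G H : Type u) [Group G] [Group H] : AddSubgroup (DoubleBurnside G H) :=
  AddSubgroup.closure {b | ∃ X : FinGSet (G × H), X.IsBifree ∧ b = cls X}

/-- The twisted diagonal subgroup `Δ(φ(V), φ, V) = {(φ(v), v) | v ∈ V}` of `G × H`. -/
def twistedDiag (φ : H ≃* G) (V : Subgroup H) : Subgroup (G × H) :=
  V.map (φ.toMonoidHom.prod (MonoidHom.id H))

/-- `γ` is uniform: for some isomorphism `φ : H → G` it lies in the `ℤ`-span of the elements
`[(G × H)/Δ(φ(V), φ, V)]`, `V ≤ H`. -/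
def IsUniform [Finite G] [Finite H] (γ : DoubleBurnside G H) : Prop :=
  ∃ φ : H ≃* G, γ ∈ AddSubgroup.closure
    (Set.range fun V : Subgroup H => cls (coset (twistedDiag φ V)))

/-- The set `B^Δ_∘(G, H)` of all `γ ∈ B^Δ(G, H)` with `γ ·_H γ° = [G]` and `γ° ·_G γ = [H]`. -/
def orth (G H : Type u) [Group G] [Group H] [Finite G] [Finite H] : Set (DoubleBurnside G H) :=
  {γ | γ ∈ bifree G H ∧ tensor γ (op γ) = unit G ∧ tensor (op γ) γ = unit H}

theorem op_cls (X : FinGSet (G × H)) : op (cls X) = cls X.op := map_cls _ _ _ _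

theorem tensor_cls (X : FinGSet (G × H)) (Y : FinGSet (H × K)) :
    tensor (cls X) (cls Y) = cls (X.tensor Y) := map₂_cls _ _ _ _ _ _

theorem tensor_sub_left (a b : DoubleBurnside G H) (c : DoubleBurnside H K) :
    tensor (a - b) c = tensor a c - tensor b c := by simp

theorem tensor_assoc (a : DoubleBurnside G H) (b : DoubleBurnside H K) (c : DoubleBurnside K M) :
    tensor (tensor a b) c = tensor a (tensor b c) := by
  induction a using Burnside.induction with
  | h₂ a a' ha ha' => simp only [tensor_sub_left, ha, ha']
  | h₁ X =>
    induction b using Burnside.induction with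
    | h₂ a a' ha ha' => rw [map_sub, tensor_sub_left, ha, ha', tensor_sub_left, map_sub]
    | h₁ Y =>
      induction c using Burnside.induction with
      | h₂ a a' ha ha' => simp only [map_sub, ha, ha']
      | h₁ Z => simp only [tensor_cls]; exact cls_eq (FinGSet.tensor_assoc X Y Z)

theorem unit_tensor [Finite G] (a : DoubleBurnside G H) : tensor (unit G) a = a := by
  induction a using Burnside.induction with
  | h₂ a a' ha ha' => rw [map_sub, ha, ha']
  | h₁ X => exact (tensor_cls _ _).trans (cls_eq (regular_tensor X))

theorem tensor_unit [Finite H] (a : DoubleBurnside G H) : tensor a (unit H) = a := by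
  induction a using Burnside.induction with
  | h₂ a a' ha ha' => rw [tensor_sub_left, ha, ha']
  | h₁ X => exact (tensor_cls _ _).trans (cls_eq (tensor_regular X))

theorem op_op (a : DoubleBurnside G H) : op (op a) = a := by
  induction a using Burnside.induction with
  | h₂ a a' ha ha' => simp only [map_sub, ha, ha']
  | h₁ X => simp only [op_cls]; exact cls_eq (FinGSet.op_op X)

theorem op_tensor (a : DoubleBurnside G H) (b : DoubleBurnside H K) :
    op (tensor a b) = tensor (op b) (op a) := by
  induction a using Burnside.induction with
  | h₂ a a' ha ha' => rw [tensor_sub_left, map_sub, ha, ha', map_sub, map_sub]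
  | h₁ X =>
    induction b using Burnside.induction with
    | h₂ a a' ha ha' => rw [map_sub, map_sub, ha, ha', map_sub, tensor_sub_left]
    | h₁ Y => simp only [op_cls, tensor_cls]; exact cls_eq (FinGSet.op_tensor X Y)

theorem op_unit [Finite G] : op (unit G) = unit G :=
  (op_cls _).trans (cls_eq op_regular)

theorem unit_mem_bifree [Finite G] : unit G ∈ bifree G G :=
  AddSubgroup.subset_closure ⟨_, isBifree_regular, rfl⟩

theorem op_mem_bifree {a : DoubleBurnside G H} (ha : a ∈ bifree G H) : op a ∈ bifree H G := by
  refine AddSubgroup.closure_induction (p := fun a _ => op a ∈ bifree H G) ?_ ?_ ?_ ?_ ha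
  · rintro _ ⟨X, hX, rfl⟩
    exact AddSubgroup.subset_closure ⟨X.op, hX.op, op_cls X⟩
  · rw [map_zero]; exact zero_mem _
  · intro a b _ _ h h'; rw [map_add]; exact add_mem h h'
  · intro a _ h; rw [map_neg]; exact neg_mem h

theorem tensor_mem_bifree {a : DoubleBurnside G H} {b : DoubleBurnside H K}
    (ha : a ∈ bifree G H) (hb : b ∈ bifree H K) : tensor a b ∈ bifree G K := by
  refine AddSubgroup.closure_induction (p := fun a _ => tensor a b ∈ bifree G K) ?_ ?_ ?_ ?_ ha
  · rintro _ ⟨X, hX, rfl⟩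
    refine AddSubgroup.closure_induction (p := fun b _ => tensor (cls X) b ∈ bifree G K)
      ?_ ?_ ?_ ?_ hb
    · rintro _ ⟨Y, hY, rfl⟩
      exact AddSubgroup.subset_closure ⟨_, hX.tensor hY, tensor_cls X Y⟩
    · rw [map_zero]; exact zero_mem _
    · intro a b _ _ h h'; rw [map_add]; exact add_mem h h'
    · intro a _ h; rw [map_neg]; exact neg_mem h
  · simp
  · intro a b _ _ h h'; simpa using add_mem h h'
  · intro a _ h; simpa using h

/-- The group `B^Δ_∘(G, G)` of orthogonal units of `B^Δ(G, G)`. -/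
def OrthUnit (G : Type u) [Group G] [Finite G] : Type (u + 1) := orth G G

/-- The group structure given by `· _G ·`, with identity `[G]` and inverse `γ ↦ γ°`. -/
instance (G : Type u) [Group G] [Finite G] : Group (OrthUnit G) where
  mul a b := ⟨tensor a.1 b.1, tensor_mem_bifree a.2.1 b.2.1, by
    rw [op_tensor, tensor_assoc, ← tensor_assoc b.1, b.2.2.1, unit_tensor, a.2.2.1], by
    rw [op_tensor, tensor_assoc, ← tensor_assoc _ a.1, a.2.2.2, unit_tensor, b.2.2.2]⟩
  one := ⟨unit G, unit_mem_bifree, by rw [op_unit, unit_tensor], by rw [op_unit, unit_tensor]⟩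
  inv a := ⟨op a.1, op_mem_bifree a.2.1, by rw [op_op, a.2.2.2], by rw [op_op, a.2.2.1]⟩
  mul_assoc a b c := Subtype.ext (tensor_assoc a.1 b.1 c.1)
  one_mul a := Subtype.ext (unit_tensor a.1)
  mul_one a := Subtype.ext (tensor_unit a.1)
  inv_mul_cancel a := Subtype.ext a.2.2.2

end DoubleBurnside

end

end BurnsideBiset

/-! An element of a Burnside group is determined by its marks, the fixed point counts of subgroups.
Subgroups of $G\times H$ are replaced by pairs of homomorphisms $\alpha\colon W\to G$, $\beta\colon
W\to H$ from a test group $W$, so that $\gamma\in B^\Delta(G,H)$ becomes a matrix $m(\alpha,\beta)$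
with $m(\alpha,\beta)$ the mark at the image of $(\alpha,\beta)$. On bifree elements the tensor
product becomes the matrix product divided by $|H|$ (`mark_tensor`), and $\gamma^\circ$ has the
transposed matrix.

The key is a rigidity of rows. If $\gamma\cdot_H\gamma^\circ=[G]$, then $\sum_\beta
m(\alpha,\beta)^2=|H|\,|C_G(\alpha)|$. By freeness on both sides, $m(\alpha,\beta)$ is divisible by
$|C_G(\alpha)|$ and by $|C_H(\beta)|$. A non-zero entry is therefore at least as large as both
numbers, while the $H$-class of $\beta$, which has $|H|/|C_H(\beta)|$ elements, gives
$m(\alpha,\beta)^2\le|C_G(\alpha)||C_H(\beta)|$. Everything is an equality: the row is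
$\pm|C_G(\alpha)|$ on one conjugacy class and zero elsewhere (`exists_mark_eq`).

The entries are thus bounded, which gives (b). The row of the identity of $G$ yields an injective
$G\to H$, and the trivial test group yields $|G|=|H|$, hence (c). Once $G\cong H$, (a) is a
statement in the ring $B(G,G)$, a finitely generated abelian group, where right inverses are left
inverses. The column of the identity of $H$ is supported on one class of isomorphisms $\phi$; such a
mark is non-zero exactly when the corresponding coefficient is, because no basis element of
$B^\Delta(G,H)$ belongs to a larger subgroup. This is the first half of (d).

For uniformity, marks are compared along $U\trianglelefteq N$ with $N/U$ a $p$-group. Counting fixed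
points of $N$ on centralizer orbits gives a congruence modulo $p\,|C_G(\alpha|_U)|$
(`dvd_mark_sub_sum`); since the entries are signs times centralizer orders, a non-zero mark on $N$
stays non-zero on $U$ (`mark_restrict_ne_zero`). In a nilpotent group every subgroup is reached from
the top by such steps, so $m(\phi|_V,V)\ne0$ for all $V\le H$. By rigidity of columns all non-zero
marks lie at subgroups conjugate into $\Delta(G,\phi,H)$, and triangularity makes $\gamma$ uniform.

For (e), uniform elements of $B^\Delta(G,G)$ are the elements `diag φ a` with $a\in B(G)$,
multiplied as in a semidirect product (`tensor_diag`). Orthogonality of `diag φ a` means $a^2=1$,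
which every unit of $B(G)$ satisfies because its marks are $\pm1$. -/

namespace BurnsideBiset

noncomputable section

open FinGSet Burnside

/-! ## Marks -/

namespace FinGSet

variable {G : Type u} [Group G] {W : Type*} [Group W]

/-- The points of `X` fixed by the image of `ρ`. -/
abbrev FixedBy (ρ : W →* G) (X : FinGSet G) : Type u :=
  {x : X.carrier // ∀ w, ρ w • x = x}

theorem card_fixedBy_congr (ρ : W →* G) {X Y : FinGSet G} :
    Iso X Y → Nat.card (FixedBy ρ X) = Nat.card (FixedBy ρ Y) := by
  rintro ⟨e, he⟩
  refine Nat.card_congr (e.subtypeEquiv fun x => forall_congr' fun w => ?_)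
  rw [← he, e.injective.eq_iff]

theorem card_fixedBy_sum (ρ : W →* G) (X Y : FinGSet G) :
    Nat.card (FixedBy ρ (sum X Y)) = Nat.card (FixedBy ρ X) + Nat.card (FixedBy ρ Y) := by
  rw [← Nat.card_sum]
  refine Nat.card_congr ((Equiv.subtypeSum).trans (Equiv.sumCongr
    (Equiv.subtypeEquivRight fun x => forall_congr' fun w => ?_)
    (Equiv.subtypeEquivRight fun x => forall_congr' fun w => ?_)))
  · exact Sum.inl_injective.eq_iff (a := ρ w • x) (b := x)
  · exact Sum.inr_injective.eq_iff (a := ρ w • x) (b := x)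

theorem card_fixedBy_prod (ρ : W →* G) (X Y : FinGSet G) :
    Nat.card (FixedBy ρ (prod X Y)) = Nat.card (FixedBy ρ X) * Nat.card (FixedBy ρ Y) := by
  rw [← Nat.card_prod]
  refine Nat.card_congr ((Equiv.subtypeEquivRight fun x => ?_).trans Equiv.subtypeProdEquivProd)
  refine Iff.trans (forall_congr' fun w => Prod.ext_iff) forall_and

/-- A transitive `G`-set is determined by the stabilizer of a point. -/
theorem iso_coset_of_stabilizer [Finite G] {X : FinGSet G} {L : Subgroup G} (x : X.carrier)
    (ht : ∀ y : X.carrier, ∃ g : G, g • x = y) (hs : MulAction.stabilizer G x = L) :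
    Iso (coset L) X := by
  subst hs
  refine ⟨(MulAction.orbitEquivQuotientStabilizer G x).symm.trans
    (Equiv.subtypeUnivEquiv ht), fun g y => ?_⟩
  induction y using QuotientGroup.induction_on with
  | _ a => exact mul_smul g a x

end FinGSet

/-- The conjugate homomorphism `w ↦ g ρ(w) g⁻¹`. -/
abbrev conjHom {G W : Type*} [Group G] [Group W] (g : G) (ρ : W →* G) : W →* G :=
  (MulAut.conj g).toMonoidHom.comp ρ

theorem conjHom_apply {G W : Type*} [Group G] [Group W] (g : G) (ρ : W →* G) (w : W) :
    conjHom g ρ w = g * ρ w * g⁻¹ := rfl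

namespace Burnside

variable {G : Type u} [Group G] {W : Type*} [Group W]

/-- The additive map `[X] ↦ |X^{ρ(W)}|`. -/
def mark (ρ : W →* G) : Burnside G →+ ℤ :=
  lift (ofAdd (Quotient.lift (fun X => (Nat.card (FixedBy ρ X) : ℤ))
      fun _ _ h => congrArg Nat.cast (card_fixedBy_congr ρ h))
    (GSetClass.ind fun X => GSetClass.ind fun Y => by
      change ((Nat.card (FixedBy ρ (sum X Y)) : ℕ) : ℤ) =
        Nat.card (FixedBy ρ X) + Nat.card (FixedBy ρ Y)
      rw [card_fixedBy_sum]; push_cast; rfl))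

theorem mark_cls (ρ : W →* G) (X : FinGSet G) : mark ρ (cls X) = Nat.card (FixedBy ρ X) := by
  rw [mark, lift_cls]; rfl

theorem mark_mul (ρ : W →* G) (a b : Burnside G) : mark ρ (a * b) = mark ρ a * mark ρ b := by
  induction a using Burnside.induction with
  | h₂ a a' ha ha' => rw [sub_mul, map_sub, ha, ha', map_sub, sub_mul]
  | h₁ X =>
    induction b using Burnside.induction with
    | h₂ b b' hb hb' => rw [mul_sub, map_sub, hb, hb', map_sub, mul_sub]
    | h₁ Y => rw [cls_mul, mark_cls, card_fixedBy_prod, mark_cls, mark_cls, Nat.cast_mul]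

theorem mark_one (ρ : W →* G) : mark ρ (1 : Burnside G) = 1 := by
  rw [one_def, mark_cls]
  have : Unique (FixedBy ρ (point G)) :=
    { default := ⟨PUnit.unit, fun _ => rfl⟩
      uniq := fun x => Subtype.ext (Subsingleton.elim (α := PUnit) _ _) }
  rw [Nat.card_unique, Nat.cast_one]

theorem mark_congr_range {W' : Type*} [Group W'] {ρ : W →* G} {ρ' : W' →* G}
    (h : ρ.range = ρ'.range) (a : Burnside G) : mark ρ a = mark ρ' a := by
  have key : ∀ (X : FinGSet G) (x : X.carrier),
      (∀ w, ρ w • x = x) ↔ ∀ w, ρ' w • x = x := fun X x => by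
    have h1 : (∀ w, ρ w • x = x) ↔ ∀ g ∈ ρ.range, g • x = x := by simp
    have h2 : (∀ w, ρ' w • x = x) ↔ ∀ g ∈ ρ'.range, g • x = x := by simp
    rw [h1, h2, h]
  induction a using Burnside.induction with
  | h₂ a b ha hb => rw [map_sub, map_sub, ha, hb]
  | h₁ X =>
    rw [mark_cls, mark_cls]
    exact congrArg _ (Nat.card_congr (Equiv.subtypeEquivRight (key X)))

theorem mark_conjHom (g : G) (ρ : W →* G) (a : Burnside G) :
    mark (conjHom g ρ) a = mark ρ a := by
  induction a using Burnside.induction with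
  | h₂ a b ha hb => rw [map_sub, map_sub, ha, hb]
  | h₁ X =>
    rw [mark_cls, mark_cls]
    refine congrArg _ (Nat.card_congr ((MulAction.toPerm g⁻¹).subtypeEquiv fun x =>
      forall_congr' fun w => ?_))
    rw [conjHom_apply, MulAction.toPerm_apply, mul_assoc, mul_smul, ← eq_inv_smul_iff, mul_smul]

variable [Finite G]

theorem mark_coset_ne_zero_iff (K L : Subgroup G) :
    mark K.subtype (cls (coset L)) ≠ 0 ↔ ∃ g : G, K ≤ L.map (MulAut.conj g).toMonoidHom := by
  rw [mark_cls, Nat.cast_ne_zero, Nat.card_ne_zero,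
    and_iff_left (inferInstance : Finite (FixedBy K.subtype (coset L)))]
  have hst : ∀ g : G, MulAction.stabilizer G (g : G ⧸ L) = L.map (MulAut.conj g).toMonoidHom := by
    intro g
    have h1 : ((g : G) : G ⧸ L) = g • ((1 : G) : G ⧸ L) := by
      rw [MulAction.Quotient.smul_coe, smul_eq_mul, mul_one]
    rw [h1, MulAction.stabilizer_smul_eq_stabilizer_map_conj, MulAction.stabilizer_quotient]
  constructor
  · rintro ⟨x, hx⟩
    induction x using QuotientGroup.induction_on with
    | _ g => exact ⟨g, fun k hk => by rw [← hst]; exact hx ⟨k, hk⟩⟩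
  · rintro ⟨g, hg⟩
    refine ⟨⟨(g : G ⧸ L), fun k => ?_⟩⟩
    have := hg k.2
    rwa [← hst] at this

/-! ### The standard basis -/

/-- Conjugacy of subgroups. -/
def conjSetoid (G : Type u) [Group G] : Setoid (Subgroup G) where
  r L M := ∃ g : G, L.map (MulAut.conj g).toMonoidHom = M
  iseqv :=
    { refl := fun L => ⟨1, by ext; simp⟩
      symm := by
        rintro L _ ⟨g, rfl⟩
        refine ⟨g⁻¹, ?_⟩
        ext x
        simp [mul_assoc]
      trans := by
        rintro L _ _ ⟨g, rfl⟩ ⟨h, rfl⟩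
        refine ⟨h * g, ?_⟩
        rw [Subgroup.map_map]
        congr 1
        ext x
        simp [mul_assoc] }

/-- Conjugacy classes of subgroups. -/
abbrev SubgroupConjClass (G : Type u) [Group G] : Type u := Quotient (conjSetoid G)

theorem coset_iso_of_conj {L M : Subgroup G} (h : ∃ g : G, L.map (MulAut.conj g).toMonoidHom = M) :
    Iso (coset L) (coset M) := by
  obtain ⟨g, rfl⟩ := h
  exact (twist_conj g _).symm.trans (twist_coset _ _)

/-- Both sides are additive, so only transitive sets have to be checked, and for these a single
conjugacy class contributes. -/
theorem eq_sum_coeff [Fintype (SubgroupConjClass G)] (a : Burnside G) :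
    a = ∑ q : SubgroupConjClass G, coeff q.out a • cls (coset q.out) := by
  classical
  have ha : a ∈ AddSubgroup.closure (Set.range fun L : Subgroup G => cls (coset L)) := by
    rw [closure_coset]; trivial
  induction ha using AddSubgroup.closure_induction with
  | zero => simp
  | add a b _ _ ha hb =>
    simp only [map_add, add_smul, Finset.sum_add_distrib]
    rw [← ha, ← hb]
  | neg a _ ha =>
    simp only [map_neg, neg_smul, Finset.sum_neg_distrib]
    rw [← ha]
  | mem _ h =>
    obtain ⟨L, rfl⟩ := h
    have hq : ∀ q : SubgroupConjClass G,
        (∃ g : G, L.map (MulAut.conj g).toMonoidHom = q.out) ↔ Quotient.mk (conjSetoid G) L = q := by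
      intro q
      refine Iff.trans ?_ (Quotient.mk_eq_iff_out (s := conjSetoid G)).symm
      rfl
    dsimp only
    rw [Finset.sum_eq_single (Quotient.mk (conjSetoid G) L)]
    · rw [coeff_coset, if_pos ((hq _).2 rfl), one_smul]
      exact cls_eq (coset_iso_of_conj ((hq _).2 rfl))
    · intro q _ hne
      rw [coeff_coset, if_neg fun h => hne ((hq _).1 h).symm, zero_smul]
    · exact fun h => (h (Finset.mem_univ _)).elim

theorem coeff_conj {L M : Subgroup G} (h : ∃ g : G, L.map (MulAut.conj g).toMonoidHom = M)
    (a : Burnside G) : coeff L a = coeff M a := by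
  classical
  have ha : a ∈ AddSubgroup.closure (Set.range fun L : Subgroup G => cls (coset L)) := by
    rw [closure_coset]; trivial
  induction ha using AddSubgroup.closure_induction with
  | zero => simp
  | add a b _ _ ha hb => rw [map_add, map_add, ha, hb]
  | neg a _ ha => rw [map_neg, map_neg, ha]
  | mem _ hR =>
    obtain ⟨R, rfl⟩ := hR
    dsimp only
    rw [coeff_coset, coeff_coset]
    refine if_congr ⟨fun h' => ?_, fun h' => ?_⟩ rfl rfl
    · exact (conjSetoid G).iseqv.trans h' h
    · exact (conjSetoid G).iseqv.trans h' ((conjSetoid G).iseqv.symm h)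

/-- Triangularity of the table of marks. -/
theorem mark_eq_coeff_mul (K : Subgroup G) (a : Burnside G)
    (h : ∀ L : Subgroup G, K < L → coeff L a = 0) :
    mark K.subtype a = coeff K a * mark K.subtype (cls (coset K)) := by
  classical
  have := Fintype.ofFinite (SubgroupConjClass G)
  conv_lhs => rw [eq_sum_coeff a]
  rw [map_sum]
  simp only [map_zsmul, smul_eq_mul]
  have hK : ∃ g : G, (Quotient.mk (conjSetoid G) K).out.map (MulAut.conj g).toMonoidHom = K :=
    Quotient.mk_out (s := conjSetoid G) K
  rw [Finset.sum_eq_single (Quotient.mk (conjSetoid G) K)]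
  · rw [coeff_conj hK, cls_eq (coset_iso_of_conj hK)]
  · intro q _ hne
    -- A non-zero term for $L$ needs $K\le gLg^{-1}$. Equality puts $L$ in the class of $K$; strict
    -- inclusion kills the coefficient by hypothesis.
    by_contra hq
    obtain ⟨h1, h2⟩ := mul_ne_zero_iff.1 hq
    obtain ⟨g, hg⟩ := (mark_coset_ne_zero_iff _ _).1 h2
    rcases hg.eq_or_lt with he | hl
    · refine hne ?_
      rw [← Quotient.out_eq q]
      exact Quotient.sound (s := conjSetoid G) ⟨g, he.symm⟩
    · exact h1 ((coeff_conj ⟨g, rfl⟩ a).trans (h _ hl))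
  · exact fun h => (h (Finset.mem_univ _)).elim

theorem mark_coset_self_ne_zero (K : Subgroup G) : mark K.subtype (cls (coset K)) ≠ 0 :=
  (mark_coset_ne_zero_iff K K).2 ⟨1, by rintro x hx; simpa using hx⟩

/-- If all marks of `a` outside a set `F` of subgroups that is closed under passage to subgroups
vanish, then `a` lies in the span of the elements `[G/L]` with `L ∈ F`. -/
theorem mem_closure_of_mark_eq_zero (F : Set (Subgroup G)) (hF : ∀ K L, K ≤ L → L ∈ F → K ∈ F)
    (a : Burnside G) (h : ∀ K ∉ F, mark K.subtype a = 0) :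
    a ∈ AddSubgroup.closure ((fun L : Subgroup G => cls (coset L)) '' F) := by
  -- Induction from large subgroups to small ones: everything above a subgroup outside $F$ is again
  -- outside $F$, so triangularity applies.
  have hc : ∀ K : Subgroup G, K ∉ F → coeff K a = 0 := by
    intro K
    induction K using WellFoundedGT.induction with
    | _ K ih =>
      intro hK
      have h1 := mark_eq_coeff_mul K a fun L hL => ih L hL fun hLF => hK (hF _ _ hL.le hLF)
      rw [h K hK] at h1
      exact (mul_eq_zero.1 h1.symm).resolve_right (mark_coset_self_ne_zero K)
  have := Fintype.ofFinite (SubgroupConjClass G)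
  rw [eq_sum_coeff a]
  refine sum_mem fun q _ => ?_
  by_cases hq : q.out ∈ F
  · exact zsmul_mem (AddSubgroup.subset_closure
      (Set.mem_image_of_mem (fun L : Subgroup G => cls (coset L)) hq)) _
  · rw [hc _ hq, zero_smul]
    exact zero_mem _

/-- Burnside's theorem, obtained as the case $F=\emptyset$. -/
theorem eq_zero_of_mark_eq_zero {a : Burnside G} (h : ∀ K : Subgroup G, mark K.subtype a = 0) :
    a = 0 := by
  simpa using mem_closure_of_mark_eq_zero ∅ (fun _ _ _ h => h.elim) a fun K _ => h K

theorem ext_mark {a b : Burnside G} (h : ∀ K : Subgroup G, mark K.subtype a = mark K.subtype b) :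
    a = b :=
  sub_eq_zero.1 (eq_zero_of_mark_eq_zero fun K => by rw [map_sub, h, sub_self])

/-- The marks are ring homomorphisms to $\mathbb Z$, so those of a unit are $\pm1$, and marks
separate elements. -/
theorem units_mul_self (v : (Burnside G)ˣ) : (v : Burnside G) * v = 1 := by
  refine ext_mark fun K => ?_
  rw [mark_mul, mark_one]
  have h : mark K.subtype (v : Burnside G) *
      mark K.subtype ((v⁻¹ : (Burnside G)ˣ) : Burnside G) = 1 := by
    rw [← mark_mul, Units.mul_inv, mark_one]
  rcases Int.isUnit_iff.1 (IsUnit.of_mul_eq_one _ h) with h | h <;> rw [h] <;> rfl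

/-- This makes surjective endomorphisms of $B(G,G)$ injective, which is the source of (a). -/
instance : Module.Finite ℤ (Burnside G) := by
  rw [Module.finite_def, Submodule.fg_def]
  refine ⟨_, Set.finite_range fun L : Subgroup G => cls (coset L), ?_⟩
  rw [← Submodule.toAddSubgroup_inj, Submodule.span_int_eq_addSubgroupClosure]
  exact closure_coset

end Burnside

/-! ## Conjugate homomorphisms -/

section ConjCount

variable {G W : Type*} [Group G] [Group W]

/-- The number of `g ∈ G` with `α = g β g⁻¹`. -/
def conjCount (α β : W →* G) : ℕ := Nat.card {g : G // α = conjHom g β}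

theorem conjHom_mul (g h : G) (α : W →* G) : conjHom (g * h) α = conjHom g (conjHom h α) := by
  ext w; simp [mul_assoc]

theorem conjHom_one (α : W →* G) : conjHom 1 α = α := by
  ext w; simp

theorem conjHom_inv_conjHom (g : G) (α : W →* G) : conjHom g⁻¹ (conjHom g α) = α := by
  rw [← conjHom_mul, inv_mul_cancel, conjHom_one]

theorem conjCount_conjHom (g : G) (β : W →* G) :
    conjCount (conjHom g β) β = conjCount β β := by
  refine Nat.card_congr ((Equiv.mulLeft g⁻¹).subtypeEquiv fun h => ?_)
  rw [Equiv.coe_mulLeft, conjHom_mul]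
  constructor
  · rintro h1
    rw [← h1, conjHom_inv_conjHom]
  · intro h1
    nth_rw 1 [h1]
    rw [← conjHom_mul, mul_inv_cancel, conjHom_one]

theorem conjCount_conjHom_right (g : G) (α β : W →* G) :
    conjCount α (conjHom g β) = conjCount α β := by
  refine Nat.card_congr ((Equiv.mulRight g).subtypeEquiv fun h => ?_)
  rw [Equiv.coe_mulRight, conjHom_mul]

theorem conjCount_eq_zero {α β : W →* G} (h : ∀ g, α ≠ conjHom g β) : conjCount α β = 0 := by
  have : IsEmpty {g : G // α = conjHom g β} := ⟨fun g => h _ g.2⟩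
  exact Nat.card_of_isEmpty

theorem conjCount_self_pos [Finite G] (α : W →* G) : 0 < conjCount α α :=
  have : Nonempty {g : G // α = conjHom g α} := ⟨⟨1, (conjHom_one α).symm⟩⟩
  Nat.card_pos

theorem conjCount_ne_zero_iff [Finite G] {α β : W →* G} :
    conjCount α β ≠ 0 ↔ ∃ g, α = conjHom g β := by
  constructor
  · intro h
    by_contra! h'
    exact h (conjCount_eq_zero h')
  · rintro ⟨g, rfl⟩
    rw [conjCount_conjHom]
    exact (conjCount_self_pos β).ne'

/-- Each $g\in G$ is counted exactly once, at $\alpha=g\beta g^{-1}$. -/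
theorem sum_conjCount [Finite G] [Fintype (W →* G)] (β : W →* G) :
    ∑ α, conjCount α β = Nat.card G := by
  have e : G ≃ Σ α : W →* G, {g : G // α = conjHom g β} :=
    { toFun := fun g => ⟨conjHom g β, g, rfl⟩
      invFun := fun s => s.2.1
      left_inv := fun _ => rfl
      right_inv := by rintro ⟨_, g, rfl⟩; rfl }
  rw [Nat.card_congr e, Nat.card_sigma]
  rfl

/-- The centralizer of the image of `α`. -/
abbrev homCentralizer (α : W →* G) : Subgroup G := Subgroup.centralizer (Set.range α)

theorem mem_homCentralizer {α : W →* G} {g : G} :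
    g ∈ homCentralizer α ↔ ∀ w, α w * g = g * α w := by
  rw [Subgroup.mem_centralizer_iff, Set.forall_mem_range]

theorem card_homCentralizer (α : W →* G) : Nat.card (homCentralizer α) = conjCount α α := by
  refine Nat.card_congr (Equiv.subtypeEquivRight fun g => ?_)
  rw [mem_homCentralizer, MonoidHom.ext_iff]
  refine forall_congr' fun w => ?_
  rw [conjHom_apply, eq_mul_inv_iff_mul_eq]

/-- A conjugation invariant integral function on homomorphisms with small square sum and with values
divisible by orders of centralizers is supported on a single conjugacy class. -/
theorem exists_eq_sign_mul_conjCount [Finite G] [Fintype (W →* G)] (f : (W →* G) → ℤ)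
    (hf : ∀ g β, f (conjHom g β) = f β) (c : ℕ) (hc : 0 < c) (h1 : ∀ β, (c : ℤ) ∣ f β)
    (h2 : ∀ β, (conjCount β β : ℤ) ∣ f β) (hs : ∑ β, f β ^ 2 = Nat.card G * c) :
    ∃ (β₀ : W →* G) (ε : ℤ), ε ^ 2 = 1 ∧ conjCount β₀ β₀ = c ∧
      ∀ β, f β = ε * conjCount β β₀ := by
  have hG : 0 < Nat.card G := Nat.card_pos
  obtain ⟨β₀, h0⟩ : ∃ β₀, f β₀ ≠ 0 := by
    by_contra! h
    simp only [h] at hs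
    have : (0 : ℤ) < Nat.card G * c := by positivity
    simp at hs
    omega
  set d := conjCount β₀ β₀ with hd
  have hdpos : 0 < d := conjCount_self_pos β₀
  -- On the class of $\beta_0$ both sides equal $d\,f(\beta_0)^2$; off the class the left side is
  -- $0$. Equality in the sum will thus force $f$ to vanish off the class.
  have hle : ∀ β ∈ Finset.univ, f β₀ ^ 2 * (conjCount β β₀ : ℤ) ≤ d * f β ^ 2 := by
    intro β _
    by_cases h : ∃ g, β = conjHom g β₀
    · obtain ⟨g, rfl⟩ := h
      rw [conjCount_conjHom, hf, mul_comm]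
    · rw [conjCount_eq_zero (not_exists.1 h)]
      simp only [Nat.cast_zero, mul_zero]
      positivity
  have hsum : ∑ β, f β₀ ^ 2 * (conjCount β β₀ : ℤ) = f β₀ ^ 2 * Nat.card G := by
    rw [← Finset.mul_sum, ← Nat.cast_sum, sum_conjCount]
  have hsum' : ∑ β, (d : ℤ) * f β ^ 2 = d * (Nat.card G * c) := by
    rw [← Finset.mul_sum, hs]
  have hub : f β₀ ^ 2 ≤ d * c := by
    have h3 := Finset.sum_le_sum hle
    rw [hsum, hsum'] at h3
    have h4 : (0 : ℤ) < Nat.card G := by exact_mod_cast hG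
    nlinarith
  have hlc : (c : ℤ) ≤ |f β₀| := Int.le_of_dvd (abs_pos.2 h0) ((dvd_abs _ _).2 (h1 β₀))
  have hld : (d : ℤ) ≤ |f β₀| := Int.le_of_dvd (abs_pos.2 h0) ((dvd_abs _ _).2 (h2 β₀))
  rw [← sq_abs] at hub
  have hdpos' : (0 : ℤ) < d := by exact_mod_cast hdpos
  have hcpos' : (0 : ℤ) < c := by exact_mod_cast hc
  -- $|f(\beta_0)|\ge c,d$ together with $f(\beta_0)^2\le dc$ leaves no room.
  have hfd : |f β₀| = d := by nlinarith
  have hfc : |f β₀| = c := by nlinarith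
  have hdc : d = c := by exact_mod_cast hfd.symm.trans hfc
  have hterm := (Finset.sum_eq_sum_iff_of_le hle).1 (by
    rw [hsum, hsum', ← sq_abs, hfd, hdc]; ring)
  have hoff : ∀ β, (∀ g, β ≠ conjHom g β₀) → f β = 0 := by
    intro β hβ
    have h3 := hterm β (Finset.mem_univ _)
    rw [conjCount_eq_zero hβ] at h3
    simp only [Nat.cast_zero, mul_zero] at h3
    have := (mul_eq_zero.1 h3.symm).resolve_left hdpos'.ne'
    exact pow_eq_zero_iff (two_ne_zero) |>.1 this
  obtain ⟨ε, hε, hε'⟩ : ∃ ε : ℤ, ε ^ 2 = 1 ∧ f β₀ = ε * d := by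
    rcases abs_eq hdpos'.le |>.1 hfd with h | h
    · exact ⟨1, by norm_num, by rw [h, one_mul]⟩
    · exact ⟨-1, by norm_num, by rw [h, neg_one_mul]⟩
  refine ⟨β₀, ε, hε, hdc, fun β => ?_⟩
  by_cases h : ∃ g, β = conjHom g β₀
  · obtain ⟨g, rfl⟩ := h
    rw [hf, conjCount_conjHom, hε']
  · rw [hoff _ (not_exists.1 h), conjCount_eq_zero (not_exists.1 h), Nat.cast_zero, mul_zero]

instance [Finite G] [Finite W] : Finite (W →* G) := .of_injective _ DFunLike.coe_injective

end ConjCount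

theorem card_dvd_of_free {C E : Type*} [Group C] [MulAction C E]
    (h : ∀ (c : C) (x : E), c • x = x → c = 1) :
    Nat.card E = Nat.card (MulAction.orbitRel.Quotient C E) * Nat.card C := by
  rw [← Nat.card_prod]
  refine Nat.card_congr (MulAction.selfEquivOrbitsQuotientProd fun x => ?_)
  rw [eq_bot_iff]
  exact fun c hc => h c x hc

/-! ## Marks of bisets -/

namespace FinGSet

variable {G H K : Type u} [Group G] [Group H] [Group K] {W : Type*} [Group W]

/-- Count in two ways the pairs $(x,y)$ whose class in $X\times_HY$ is fixed. The classes are free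
$H$-orbits of pairs, which gives the left side. If $x\times_Hy$ is fixed, then for each $w$ some $h$
satisfies $(\alpha(w),h)x=x$ and $(h,\kappa(w))y=y$; right freeness makes $h$ unique, so $w\mapsto
h$ is a homomorphism $\beta$, which gives the right side. -/
theorem card_fixedBy_tensor [Finite H] [Fintype (W →* H)] {X : FinGSet (G × H)}
    (Y : FinGSet (H × K)) (hX : ∀ (h : H) (x : X.carrier), ((1, h) : G × H) • x = x → h = 1)
    (α : W →* G) (κ : W →* K) :
    Nat.card H * Nat.card (FixedBy (α.prod κ) (tensor X Y)) =
      ∑ β : W →* H, Nat.card (FixedBy (α.prod β) X) * Nat.card (FixedBy (β.prod κ) Y) := by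
  let P : Type u := {p : X.carrier × Y.carrier //
    ∀ w, (α.prod κ) w • tmk X Y p.1 p.2 = tmk X Y p.1 p.2}
  have hfree : ∀ (a b : H) (x : X.carrier), ((1, a) : G × H) • x = ((1, b) : G × H) • x → a = b := by
    intro a b x hab
    rw [← inv_smul_eq_iff, smul_smul] at hab
    have := hX (b⁻¹ * a) x (by simpa using hab)
    exact (inv_mul_eq_one.1 this).symm
  have hfree' : ∀ (g : G) (a b : H) (x : X.carrier), ((g, a) : G × H) • x = x →
      ((g, b) : G × H) • x = x → a = b := by
    intro g a b x ha hb
    refine hfree a b (((g, 1) : G × H) • x) ?_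
    simpa [smul_smul] using ha.trans hb.symm
  have hP : ∀ (x : X.carrier) (y : Y.carrier) (w : W),
      (α.prod κ) w • tmk X Y x y = tmk X Y x y ↔
        ∃ h : H, ((α w, h) : G × H) • x = x ∧ ((h, κ w) : H × K) • y = y := by
    intro x y w
    rw [smul_tmk, tmk_eq_iff]
    refine exists_congr fun h => and_congr ?_ ?_ <;>
      · rw [smul_smul, eq_comm]; simp
  -- The pairs sorted by the homomorphism $\beta$ that they determine.
  have e1 : (Σ β : W →* H, FixedBy (α.prod β) X × FixedBy (β.prod κ) Y) ≃ P := by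
    refine Equiv.ofBijective (fun s => ⟨(s.2.1.1, s.2.2.1), fun w =>
      (hP _ _ w).2 ⟨s.1 w, s.2.1.2 w, s.2.2.2 w⟩⟩) ⟨?_, ?_⟩
    · rintro ⟨β, ⟨x, hx⟩, ⟨y, hy⟩⟩ ⟨β', ⟨x', hx'⟩, ⟨y', hy'⟩⟩ h
      obtain ⟨rfl, rfl⟩ := Prod.mk.inj (Subtype.mk.inj h)
      obtain rfl : β = β' := MonoidHom.ext fun w => hfree' _ _ _ x (hx w) (hx' w)
      rfl
    · rintro ⟨⟨x, y⟩, hxy⟩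
      choose β hβ hβ' using fun w => (hP x y w).1 (hxy w)
      refine ⟨⟨MonoidHom.mk' β fun v w => ?_, ⟨x, hβ⟩, ⟨y, hβ'⟩⟩, rfl⟩
      refine hfree' _ _ _ x (hβ (v * w)) ?_
      rw [map_mul, ← Prod.mk_mul_mk, mul_smul, hβ w, hβ v]
  obtain ⟨o, hout⟩ : ∃ o : (tensor X Y).carrier → X.carrier × Y.carrier,
      ∀ t, tmk X Y (o t).1 (o t).2 = t :=
    ⟨fun t : TensorCarrier X Y => Quotient.out t, fun t => Quotient.out_eq t⟩
  -- The pairs sorted by their class; within a class, $h\in H$ measures the displacement from the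
  -- chosen representative `o`.
  have e2 : H × FixedBy (α.prod κ) (tensor X Y) ≃ P := by
    have ht : ∀ (h : H) x y, tmk X Y (((1, h) : G × H) • x) (((h, 1) : H × K) • y) =
      tmk X Y x y := fun h x y => (tmk_eq_iff.2 ⟨h, rfl, rfl⟩).symm
    refine Equiv.ofBijective (fun s => ⟨(((1, s.1) : G × H) • (o s.2.1).1,
      ((s.1, 1) : H × K) • (o s.2.1).2), fun w => ?_⟩) ⟨?_, ?_⟩
    · simp only [ht]
      exact (congrArg _ (hout s.2.1)).trans ((s.2.2 w).trans (hout s.2.1).symm)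
    · rintro ⟨a, t, ht1⟩ ⟨b, s, hs1⟩ hab
      have h1 := Prod.mk.inj (Subtype.mk.inj hab)
      obtain rfl : t = s := by
        rw [← hout t, ← hout s]
        exact (ht a _ _).symm.trans ((congrArg₂ _ h1.1 h1.2).trans (ht b _ _))
      obtain rfl := hfree _ _ _ h1.1
      rfl
    · rintro ⟨⟨x, y⟩, hxy⟩
      obtain ⟨h, h1, h2⟩ := tmk_eq_iff.1 (hout (tmk X Y x y))
      exact ⟨⟨h, tmk X Y x y, hxy⟩, Subtype.ext (Prod.ext h1.symm h2.symm)⟩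
  rw [← Nat.card_prod, Nat.card_congr (e2.trans e1.symm), Nat.card_sigma]
  exact Finset.sum_congr rfl fun β _ => Nat.card_prod _ _

/-- The action of the centralizer of `α` on the fixed points of `(α, β)`. -/
instance fixedByAction (X : FinGSet (G × H)) (α : W →* G) (β : W →* H) :
    MulAction (homCentralizer α) (FixedBy (α.prod β) X) where
  smul c x := ⟨((c.1, 1) : G × H) • x.1, fun w => by
    have h1 : (α.prod β) w * ((c.1, 1) : G × H) = (c.1, 1) * (α.prod β) w :=
      Prod.ext (mem_homCentralizer.1 c.2 w) (by simp)
    rw [smul_smul, h1, mul_smul, x.2 w]⟩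
  one_smul x := Subtype.ext (one_smul (G × H) x.1)
  mul_smul c d x := Subtype.ext (by
    change (((c * d : homCentralizer α).1, 1) : G × H) • x.1 =
      ((c.1, 1) : G × H) • ((d.1, 1) : G × H) • x.1
    simp [smul_smul])

theorem fixedByAction_free {X : FinGSet (G × H)}
    (hX : ∀ (g : G) (x : X.carrier), ((g, 1) : G × H) • x = x → g = 1) (α : W →* G)
    (β : W →* H) (c : homCentralizer α) (x : FixedBy (α.prod β) X) (h : c • x = x) : c = 1 :=
  Subtype.ext (hX c.1 x.1 (Subtype.ext_iff.1 h))

end FinGSet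

/-! ### The matrix of marks of a bifree element -/

namespace DoubleBurnside

variable {G H K : Type u} [Group G] [Group H] [Group K] {W : Type*} [Group W]

theorem bifree_induction {p : (a : DoubleBurnside G H) → a ∈ bifree G H → Prop}
    (h₁ : ∀ (X : FinGSet (G × H)) (hX : X.IsBifree),
      p (cls X) (AddSubgroup.subset_closure ⟨X, hX, rfl⟩))
    (h₂ : p 0 (zero_mem _)) (h₃ : ∀ a b ha hb, p a ha → p b hb → p (a + b) (add_mem ha hb))
    (h₄ : ∀ a ha, p a ha → p (-a) (neg_mem ha)) (a : DoubleBurnside G H) (ha : a ∈ bifree G H) :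
    p a ha := by
  refine AddSubgroup.closure_induction (p := p) ?_ h₂ h₃ h₄ ha
  rintro _ ⟨X, hX, rfl⟩
  exact h₁ X hX

/-- The count for bisets extends biadditively; freeness is needed in the first factor only. -/
theorem mark_tensor [Finite H] [Fintype (W →* H)] {a : DoubleBurnside G H} (ha : a ∈ bifree G H)
    (b : DoubleBurnside H K) (α : W →* G) (κ : W →* K) :
    Nat.card H * mark (α.prod κ) (tensor a b) =
      ∑ β : W →* H, mark (α.prod β) a * mark (β.prod κ) b := by
  induction a, ha using bifree_induction with
  | h₂ => simp
  | h₃ a a' _ _ ha ha' => simp [mul_add, add_mul, Finset.sum_add_distrib, ha, ha']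
  | h₄ a _ ha => simp [ha]
  | h₁ X hX =>
    induction b using Burnside.induction with
    | h₁ Y =>
      rw [tensor_cls, mark_cls, ← Nat.cast_mul, card_fixedBy_tensor Y hX.2]
      simp [mark_cls]
    | h₂ b b' hb hb' => simp [mul_sub, Finset.sum_sub_distrib, hb, hb']

theorem mark_op (a : DoubleBurnside G H) (α : W →* G) (β : W →* H) :
    mark (β.prod α) (op a) = mark (α.prod β) a := by
  induction a using Burnside.induction with
  | h₁ X =>
    rw [op_cls, mark_cls, mark_cls]
    rfl
  | h₂ a b ha hb => rw [map_sub, map_sub, map_sub, ha, hb]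

theorem mark_unit [Finite G] (α β : W →* G) :
    mark (α.prod β) (unit G) = conjCount α β := by
  rw [unit, mark_cls]
  refine congrArg _ (Nat.card_congr (Equiv.subtypeEquivRight fun (g : G) => ?_))
  rw [MonoidHom.ext_iff]
  refine forall_congr' fun w => ?_
  rw [conjHom_apply]
  change α w * g * (β w)⁻¹ = g ↔ _
  rw [mul_inv_eq_iff_eq_mul, eq_mul_inv_iff_mul_eq]

theorem mark_conj_left (g : G) (α : W →* G) (β : W →* H) (a : DoubleBurnside G H) :
    mark ((conjHom g α).prod β) a = mark (α.prod β) a := by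
  rw [← mark_conjHom ((g, 1) : G × H) (α.prod β)]
  congr 1
  congr 1
  ext w <;> simp

theorem mark_conj_right (h : H) (α : W →* G) (β : W →* H) (a : DoubleBurnside G H) :
    mark (α.prod (conjHom h β)) a = mark (α.prod β) a := by
  rw [← mark_op, mark_conj_left, mark_op]

/-- For a bifree biset the centralizer of $\alpha(W)$ acts freely on the fixed points, and
divisibility survives sums and negatives. -/
theorem conjCount_dvd_mark_left {a : DoubleBurnside G H} (ha : a ∈ bifree G H) (α : W →* G)
    (β : W →* H) : (conjCount α α : ℤ) ∣ mark (α.prod β) a := by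
  induction a, ha using bifree_induction with
  | h₂ => simp
  | h₃ a a' _ _ ha ha' => rw [map_add]; exact dvd_add ha ha'
  | h₄ a _ ha => rw [map_neg]; exact (dvd_neg).2 ha
  | h₁ X hX =>
    rw [mark_cls, Int.natCast_dvd_natCast, card_dvd_of_free (fixedByAction_free hX.1 α β),
      card_homCentralizer]
    exact Dvd.intro_left _ rfl

theorem conjCount_dvd_mark_right {a : DoubleBurnside G H} (ha : a ∈ bifree G H) (α : W →* G)
    (β : W →* H) : (conjCount β β : ℤ) ∣ mark (α.prod β) a := by
  rw [← mark_op]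
  exact conjCount_dvd_mark_left (op_mem_bifree ha) β α

/-- At a point fixed by $(\alpha(w),\beta(w))$, triviality of one component forces that of the other
by freeness. -/
theorem injective_of_mark_ne_zero {a : DoubleBurnside G H} (ha : a ∈ bifree G H) {α : W →* G}
    {β : W →* H} (h : mark (α.prod β) a ≠ 0) (w : W) : α w = 1 ↔ β w = 1 := by
  contrapose! h
  induction a, ha using bifree_induction with
  | h₂ => simp
  | h₃ a a' _ _ ha ha' => rw [map_add, ha, ha', add_zero]
  | h₄ a _ ha => rw [map_neg, ha, neg_zero]
  | h₁ X hX =>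
    have : IsEmpty (FixedBy (α.prod β) X) := ⟨fun x => by
      have h1 : ((α w, β w) : G × H) • x.1 = x.1 := x.2 w
      rcases h with ⟨h2, h3⟩ | ⟨h2, h3⟩
      · rw [h2] at h1; exact h3 (hX.2 _ _ h1)
      · rw [h3] at h1; exact h2 (hX.1 _ _ h1)⟩
    rw [mark_cls, Nat.card_of_isEmpty, Nat.cast_zero]

theorem subtype_eq_prod (L : Subgroup (G × H)) :
    L.subtype = ((MonoidHom.fst G H).comp L.subtype).prod ((MonoidHom.snd G H).comp L.subtype) :=
  rfl

/-! ### Rows of the matrix of marks of an orthogonal element -/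

section Row

variable [Finite G] [Finite H] {γ : DoubleBurnside G H}

/-- This is the diagonal entry at $(\alpha,\alpha)$ of the matrix identity for
$\gamma\cdot_H\gamma^\circ=[G]$. -/
theorem sum_sq_mark [Fintype (W →* H)] (hγ : γ ∈ bifree G H)
    (h : tensor γ (op γ) = unit G) (α : W →* G) :
    ∑ β : W →* H, mark (α.prod β) γ ^ 2 = Nat.card H * conjCount α α := by
  rw [← mark_unit α α, ← h, mark_tensor hγ]
  exact Finset.sum_congr rfl fun β _ => by rw [mark_op, sq]

/-- The rows of the table of marks `(α, β) ↦ |γ^{(α, β)(W)}|`. -/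
theorem exists_mark_eq [Finite W] (hγ : γ ∈ bifree G H) (h : tensor γ (op γ) = unit G)
    (α : W →* G) : ∃ (β₀ : W →* H) (ε : ℤ), ε ^ 2 = 1 ∧ conjCount β₀ β₀ = conjCount α α ∧
      ∀ β, mark (α.prod β) γ = ε * conjCount β β₀ := by
  have := Fintype.ofFinite (W →* H)
  refine exists_eq_sign_mul_conjCount (fun β : W →* H => mark (α.prod β) γ) ?_ (conjCount α α)
    (conjCount_self_pos α) ?_ ?_ ?_
  · intro g β
    exact mark_conj_right g α β γ
  · intro β
    exact conjCount_dvd_mark_left hγ α β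
  · intro β
    exact conjCount_dvd_mark_right hγ α β
  · exact sum_sq_mark hγ h α

/-- For the trivial test group the centralizers are the whole groups, and rigidity equates their
orders. -/
theorem card_eq_card (hγ : γ ∈ bifree G H) (h : tensor γ (op γ) = unit G) :
    Nat.card G = Nat.card H := by
  obtain ⟨β₀, -, -, h1, -⟩ := exists_mark_eq hγ h (1 : Unit →* G)
  have hc : ∀ {A : Type u} [Group A] (α : Unit →* A), conjCount α α = Nat.card A := by
    intro A _ α
    obtain rfl : α = 1 := Subsingleton.elim _ _
    exact Nat.card_congr (Equiv.subtypeUnivEquiv fun g => Subsingleton.elim _ _)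
  rw [hc, hc] at h1
  exact h1.symm

theorem mark_ne_zero_iff_of_eq {f : ℤ} {ε : ℤ} (hε : ε ^ 2 = 1) {α β : W →* G}
    (h : f = ε * conjCount α β) : f ≠ 0 ↔ ∃ g, α = conjHom g β := by
  rw [h, mul_ne_zero_iff, Nat.cast_ne_zero, conjCount_ne_zero_iff, and_iff_right]
  rintro rfl
  simp at hε

theorem bijective_of_mark_ne_zero (hγ : γ ∈ bifree G H) (h : tensor γ (op γ) = unit G)
    {β : G →* H} (hβ : mark ((MonoidHom.id G).prod β) γ ≠ 0) : Function.Bijective β := by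
  rw [Nat.bijective_iff_injective_and_card, injective_iff_map_eq_one]
  exact ⟨fun g hg => (injective_of_mark_ne_zero hγ hβ g).2 hg, card_eq_card hγ h⟩

/-- The row of the identity of $G$ has a non-zero entry; bifreeness makes its index $\beta_0\colon
G\to H$ injective, and equality of orders makes it bijective. -/
theorem nonempty_mulEquiv (hγ : γ ∈ bifree G H) (h : tensor γ (op γ) = unit G) :
    Nonempty (G ≃* H) := by
  obtain ⟨β₀, ε, hε, -, hm⟩ := exists_mark_eq hγ h (MonoidHom.id G)
  have hne := (mark_ne_zero_iff_of_eq hε (hm β₀)).2 ⟨1, (conjHom_one _).symm⟩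
  exact ⟨MulEquiv.ofBijective β₀ (bijective_of_mark_ne_zero hγ h hne)⟩

theorem abs_mark_le [Finite W] (hγ : γ ∈ bifree G H) (h : tensor γ (op γ) = unit G)
    (α : W →* G) (β : W →* H) :
    |mark (α.prod β) γ| ≤ (Nat.card H * Nat.card G : ℕ) := by
  have := Fintype.ofFinite (W →* H)
  have h2 := Finset.single_le_sum (f := fun β : W →* H => mark (α.prod β) γ ^ 2)
    (fun β _ => sq_nonneg _) (Finset.mem_univ β)
  rw [sum_sq_mark hγ h] at h2
  have h3 : conjCount α α ≤ Nat.card G := Nat.card_le_card_of_injective _ Subtype.val_injective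
  -- An integer is bounded by its square, so the bound on the row norm suffices without taking
  -- roots.
  have h4 : |mark (α.prod β) γ| ≤ |mark (α.prod β) γ| ^ 2 := Int.le_self_sq _
  rw [sq_abs] at h4
  refine h4.trans (h2.trans ?_)
  rw [← Nat.cast_mul]
  exact Int.ofNat_le.2 (Nat.mul_le_mul_left _ h3)

/-- Marks embed the set into a bounded box of integer vectors indexed by the subgroups of $G\times
H$. -/
theorem finite_orth : (orth G H).Finite := by
  let f : DoubleBurnside G H → Subgroup (G × H) → ℤ := fun γ L => mark L.subtype γ
  refine Set.Finite.of_finite_image (f := f) ?_ fun a _ b _ hab => ext_mark fun L => congrFun hab L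
  refine (Set.Finite.pi' fun _ => Set.finite_Icc (-((Nat.card H * Nat.card G : ℕ) : ℤ))
    ((Nat.card H * Nat.card G : ℕ) : ℤ)).subset ?_
  rintro _ ⟨γ, hγ, rfl⟩ L
  rw [Set.mem_Icc, ← abs_le]
  change |mark L.subtype γ| ≤ _
  rw [subtype_eq_prod]
  exact abs_mark_le hγ.1 hγ.2.1 _ _

end Row

end DoubleBurnside

/-! ## Twisted diagonal bisets -/

namespace FinGSet

variable {G H K : Type u} [Group G] [Group H] [Group K]

/-- The `G`-set obtained from an `H`-set `X` along an isomorphism `φ : H ≃* G`. -/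
def transport (φ : H ≃* G) (X : FinGSet H) : FinGSet G :=
  letI : MulAction G X.carrier := MulAction.compHom X.carrier φ.symm.toMonoidHom
  ⟨X.carrier⟩

/-- The `(G, H)`-biset `X × G` with `g (x, a) h = (g x, g a φ(h))`. -/
def twistedBiset [Finite G] (φ : H ≃* G) (X : FinGSet G) : FinGSet (G × H) :=
  letI : MulAction (G × H) (X.carrier × G) :=
    { smul := fun p x => (p.1 • x.1, p.1 * x.2 * (φ p.2)⁻¹)
      one_smul := fun x => by
        change ((1 : G) • x.1, (1 : G) * x.2 * (φ 1)⁻¹) = x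
        simp
      mul_smul := fun p q x => by
        change ((p.1 * q.1) • x.1, (p.1 * q.1) * x.2 * (φ (p.2 * q.2))⁻¹) =
          (p.1 • q.1 • x.1, p.1 * (q.1 * x.2 * (φ q.2)⁻¹) * (φ p.2)⁻¹)
        simp [mul_smul, mul_assoc] }
  ⟨X.carrier × G⟩

theorem transport_point (φ : H ≃* G) : Iso (transport φ (point H)) (point G) :=
  ⟨Equiv.refl _, fun _ _ => rfl⟩

variable [Finite G]

theorem twistedBiset_congr (φ : H ≃* G) {X Y : FinGSet G} :
    Iso X Y → Iso (twistedBiset φ X) (twistedBiset φ Y) := by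
  rintro ⟨e, he⟩
  refine ⟨Equiv.prodCongr e (Equiv.refl G), ?_⟩
  rintro p ⟨x, a⟩
  exact Prod.ext (he p.1 x) rfl

theorem twistedBiset_sum (φ : H ≃* G) (X Y : FinGSet G) :
    Iso (twistedBiset φ (sum X Y)) (sum (twistedBiset φ X) (twistedBiset φ Y)) :=
  ⟨Equiv.sumProdDistrib _ _ _, by rintro p ⟨x | x, a⟩ <;> rfl⟩

theorem isBifree_twistedBiset (φ : H ≃* G) (X : FinGSet G) : (twistedBiset φ X).IsBifree := by
  constructor
  · rintro g ⟨x, a⟩ h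
    have h1 : g * a * (φ 1)⁻¹ = a := congrArg Prod.snd h
    simpa using h1
  · rintro g ⟨x, a⟩ h
    have h1 : 1 * a * (φ g)⁻¹ = a := congrArg Prod.snd h
    simpa using h1

theorem twistedBiset_refl_point : Iso (twistedBiset (MulEquiv.refl G) (point G)) (regular G) :=
  ⟨Equiv.punitProd G, fun _ _ => rfl⟩

theorem twistedBiset_conj (φ : H ≃* G) (X : FinGSet G) (h : H) :
    Iso (twistedBiset ((MulAut.conj h).trans φ) X) (twistedBiset φ X) := by
  refine ⟨Equiv.prodCongr (Equiv.refl _) (Equiv.mulRight (φ h)), ?_⟩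
  rintro ⟨g, k⟩ ⟨x, a⟩
  refine Prod.ext rfl ?_
  change g * a * (φ (h * k * h⁻¹))⁻¹ * φ h = g * (a * φ h) * (φ k)⁻¹
  simp [mul_assoc]

theorem op_twistedBiset [Finite H] (φ : H ≃* G) (X : FinGSet G) :
    Iso (op (twistedBiset φ X)) (twistedBiset φ.symm (transport φ.symm X)) := by
  -- The point $a^{-1}x$ is unchanged under $(x,a)\mapsto(gx,ga)$, so after passing to the opposite
  -- biset $G$ moves only the second coordinate.
  refine ⟨⟨fun p : X.carrier × G => (p.2⁻¹ • p.1, φ.symm p.2⁻¹),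
    fun p : X.carrier × H => ((φ p.2)⁻¹ • p.1, (φ p.2)⁻¹), ?_, ?_⟩, ?_⟩
  · rintro ⟨x, a⟩
    change ((φ (φ.symm a⁻¹))⁻¹ • a⁻¹ • x, (φ (φ.symm a⁻¹))⁻¹) = (x, a)
    simp
  · rintro ⟨(x : X.carrier), a⟩
    change ((φ a)⁻¹⁻¹ • (φ a)⁻¹ • x, φ.symm (φ a)⁻¹⁻¹) = (x, a)
    simp
  · rintro ⟨h, g⟩ ⟨x, a⟩
    change (((g * a * (φ h)⁻¹)⁻¹ • g • x, φ.symm (g * a * (φ h)⁻¹)⁻¹) : X.carrier × H) =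
      (φ h • a⁻¹ • x, h * φ.symm a⁻¹ * (φ.symm g)⁻¹)
    simp [smul_smul, mul_assoc]

/-- Every class has exactly one representative of the form $(x,1)\times_H(y,b)$; moving $a$ to $1$
by $h=\varphi^{-1}(a)$ replaces $y$ by $\varphi^{-1}(a)y$ and $b$ by $\varphi^{-1}(a)b$. -/
theorem tensor_twistedBiset [Finite H] (φ : H ≃* G) (ψ : K ≃* H) (X : FinGSet G) (Y : FinGSet H) :
    Iso (tensor (twistedBiset φ X) (twistedBiset ψ Y))
      (twistedBiset (ψ.trans φ) (prod X (transport φ Y))) := by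
  refine ⟨Equiv.ofBijective (tlift (X := twistedBiset φ X) (Y := twistedBiset ψ Y)
    (T := (X.carrier × Y.carrier) × G) (fun (p : X.carrier × G) (q : Y.carrier × H) =>
      ((p.1, φ.symm p.2 • q.1), p.2 * φ q.2)) ?_) ⟨?_, ?_⟩, ?_⟩
  · rintro h ⟨x, a⟩ ⟨y, b⟩
    change (((1 : G) • x, φ.symm (1 * a * (φ h)⁻¹) • h • y),
      1 * a * (φ h)⁻¹ * φ (h * b * (ψ 1)⁻¹)) = ((x, φ.symm a • y), a * φ b)
    simp [smul_smul, mul_assoc]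
  · refine tensor_ind ?_
    rintro ⟨x, a⟩ ⟨y, b⟩
    refine tensor_ind ?_
    rintro ⟨x', a'⟩ ⟨(y' : Y.carrier), b'⟩ h
    have h1 : ((x, φ.symm a • y), a * φ b) = ((x', φ.symm a' • y'), a' * φ b') := h
    obtain ⟨h2, h3⟩ := Prod.mk.inj h1
    obtain ⟨rfl, h4⟩ := Prod.mk.inj h2
    -- The only candidate: the solution $h$ of $a\,\varphi(h)^{-1}=a'$.
    refine tmk_eq_iff.2 ⟨φ.symm (a'⁻¹ * a), ?_, ?_⟩
    · refine Prod.ext (one_smul G x).symm ?_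
      change a' = 1 * a * (φ (φ.symm (a'⁻¹ * a)))⁻¹
      simp
    · refine Prod.ext ?_ ?_
      · change y' = φ.symm (a'⁻¹ * a) • y
        rw [map_mul, mul_smul, h4, smul_smul, ← map_mul, inv_mul_cancel, map_one, one_smul]
      · change b' = φ.symm (a'⁻¹ * a) * b * (ψ 1)⁻¹
        have h5 : φ b' = a'⁻¹ * (a * φ b) := by rw [h3]; simp
        rw [← φ.symm_apply_apply b', h5]
        simp [mul_assoc]
  · rintro ⟨⟨x, (y : Y.carrier)⟩, c⟩
    refine ⟨tmk (twistedBiset φ X) (twistedBiset ψ Y) (x, (1 : G)) (y, φ.symm c), ?_⟩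
    change ((x, φ.symm 1 • y), 1 * φ (φ.symm c)) = ((x, y), c)
    simp
  · rintro ⟨g, k⟩
    refine tensor_ind ?_
    rintro ⟨x, a⟩ ⟨y, b⟩
    change ((g • x, φ.symm (g * a * (φ 1)⁻¹) • (1 : H) • y),
      g * a * (φ 1)⁻¹ * φ (1 * b * (ψ k)⁻¹)) =
        ((g • x, φ.symm g • φ.symm a • y), g * (a * φ b) * (φ (ψ k))⁻¹)
    simp [smul_smul, mul_assoc]

/-- The biset is transitive, and the base point $(\varphi(V),1)$ is fixed by $(g,h)$ exactly when
$g\in\varphi(V)$ and $g=\varphi(h)$. -/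
theorem coset_twistedDiag [Finite H] (φ : H ≃* G) (V : Subgroup H) :
    Iso (coset (DoubleBurnside.twistedDiag φ V))
      (twistedBiset φ (coset (V.map φ.toMonoidHom))) := by
  refine iso_coset_of_stabilizer (X := twistedBiset φ (coset (V.map φ.toMonoidHom)))
    (((1 : G) : G ⧸ V.map φ.toMonoidHom), (1 : G)) ?_ ?_
  · rintro ⟨y, a⟩
    induction y using QuotientGroup.induction_on with
    | _ c =>
      refine ⟨(c, φ.symm (a⁻¹ * c)), Prod.ext ?_ ?_⟩
      · change ((c * 1 : G) : G ⧸ V.map φ.toMonoidHom) = (c : G ⧸ V.map φ.toMonoidHom)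
        rw [mul_one]
      · change c * 1 * (φ (φ.symm (a⁻¹ * c)))⁻¹ = a
        simp
  · ext ⟨g, h⟩
    have h1 : (g, h) ∈ DoubleBurnside.twistedDiag φ V ↔ ∃ v ∈ V, φ v = g ∧ v = h :=
      exists_congr fun v => and_congr_right fun _ => Prod.ext_iff
    rw [h1]
    refine (Prod.ext_iff (α := G ⧸ V.map φ.toMonoidHom) (β := G)).trans ?_
    change ((g * 1 : G) : G ⧸ V.map φ.toMonoidHom) = ((1 : G) : G ⧸ V.map φ.toMonoidHom) ∧
      g * 1 * (φ h)⁻¹ = 1 ↔ _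
    rw [mul_one, mul_inv_eq_one, QuotientGroup.eq, mul_one, inv_mem_iff]
    constructor
    · rintro ⟨⟨v, hv, rfl⟩, h2⟩
      exact ⟨v, hv, rfl, φ.injective h2⟩
    · rintro ⟨v, hv, rfl, rfl⟩
      exact ⟨⟨v, hv, rfl⟩, rfl⟩

theorem card_fixedBy_twistedBiset {W : Type*} [Group W] (φ : H ≃* G) (X : FinGSet G) (α : W →* G)
    (β : W →* H) : Nat.card (FixedBy (α.prod β) (twistedBiset φ X)) =
      Nat.card (FixedBy α X) * conjCount α (φ.toMonoidHom.comp β) := by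
  rw [conjCount, ← Nat.card_prod]
  refine Nat.card_congr ((Equiv.subtypeEquivRight fun (p : X.carrier × G) => ?_).trans
    Equiv.subtypeProdEquivProd)
  rw [MonoidHom.ext_iff, ← forall_and]
  refine forall_congr' fun w => (Prod.ext_iff (α := X.carrier) (β := G)).trans
    (and_congr Iff.rfl ?_)
  rw [conjHom_apply]
  change α w * p.2 * (φ (β w))⁻¹ = p.2 ↔ α w = p.2 * φ (β w) * p.2⁻¹
  rw [mul_inv_eq_iff_eq_mul, eq_mul_inv_iff_mul_eq]

end FinGSet

/-! ### The maps `diag φ` and the passage from $G$ to $H$ -/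

namespace DoubleBurnside

variable {G H K : Type u} [Group G] [Group H] [Group K] [Finite G]

/-- The additive map `B(G) → B(G, H)` with `[G/φ(V)] ↦ [(G × H)/Δ(φ(V), φ, V)]`. -/
def diag (φ : H ≃* G) : Burnside G →+ DoubleBurnside G H :=
  Burnside.map (twistedBiset φ) (fun _ _ => twistedBiset_congr φ) (twistedBiset_sum φ)

theorem diag_cls (φ : H ≃* G) (X : FinGSet G) : diag φ (cls X) = cls (twistedBiset φ X) :=
  map_cls _ _ _ _

theorem diag_mem_bifree (φ : H ≃* G) (a : Burnside G) : diag φ a ∈ bifree G H := by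
  induction a using Burnside.induction with
  | h₁ X => exact AddSubgroup.subset_closure ⟨_, isBifree_twistedBiset φ X, diag_cls φ X⟩
  | h₂ a b ha hb => rw [map_sub]; exact sub_mem ha hb

theorem diag_coset [Finite H] (φ : H ≃* G) (V : Subgroup H) :
    diag φ (cls (coset (V.map φ.toMonoidHom))) = cls (coset (twistedDiag φ V)) :=
  (diag_cls _ _).trans (cls_eq (coset_twistedDiag φ V)).symm

theorem mark_diag {W : Type*} [Group W] (φ : H ≃* G) (a : Burnside G) (α : W →* G) (β : W →* H) :
    mark (α.prod β) (diag φ a) = mark α a * conjCount α (φ.toMonoidHom.comp β) := by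
  induction a using Burnside.induction with
  | h₁ X => rw [diag_cls, mark_cls, card_fixedBy_twistedBiset, mark_cls, Nat.cast_mul]
  | h₂ a b ha hb => rw [map_sub, map_sub, ha, hb, map_sub, sub_mul]

theorem diag_refl_one : diag (MulEquiv.refl G) 1 = unit G := by
  rw [one_def, diag_cls]
  exact cls_eq twistedBiset_refl_point

theorem diag_conj (φ : H ≃* G) (h : H) (a : Burnside G) :
    diag ((MulAut.conj h).trans φ) a = diag φ a := by
  induction a using Burnside.induction with
  | h₁ X => rw [diag_cls, diag_cls]; exact cls_eq (twistedBiset_conj φ X h)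
  | h₂ a b ha hb => rw [map_sub, ha, hb, map_sub]

/-- The mark of `diag φ a` at $(L,\varphi^{-1}|_L)$ is the mark of $a$ at $L$ times $|C_G(L)|\neq0$.
-/
theorem diag_injective (φ : H ≃* G) : Function.Injective (diag φ) := by
  rw [injective_iff_map_eq_zero]
  intro a ha
  refine eq_zero_of_mark_eq_zero fun L => ?_
  have h1 := mark_diag φ a L.subtype (φ.symm.toMonoidHom.comp L.subtype)
  have h2 : φ.toMonoidHom.comp (φ.symm.toMonoidHom.comp L.subtype) = L.subtype := by ext; simp
  rw [ha, map_zero, h2] at h1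
  exact (mul_eq_zero.1 h1.symm).resolve_right
    (Nat.cast_ne_zero.2 (conjCount_self_pos L.subtype).ne')

theorem op_diag_one [Finite H] (φ : H ≃* G) : op (diag φ 1) = diag φ.symm 1 := by
  rw [one_def, diag_cls, op_cls, one_def, diag_cls]
  exact cls_eq ((op_twistedBiset φ _).trans (twistedBiset_congr _ (transport_point _)))

theorem tensor_diag_one [Finite H] (φ : H ≃* G) (ψ : K ≃* H) :
    tensor (diag φ 1) (diag ψ 1) = diag (ψ.trans φ) 1 := by
  rw [one_def, diag_cls, one_def, diag_cls, tensor_cls, diag_cls]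
  refine cls_eq ((tensor_twistedBiset φ ψ _ _).trans (twistedBiset_congr _ ?_))
  exact (point_prod _).trans (transport_point φ)

theorem tensor_diag_one_op [Finite H] (φ : H ≃* G) :
    tensor (diag φ 1) (op (diag φ 1)) = unit G := by
  rw [op_diag_one, tensor_diag_one, MulEquiv.symm_trans_self, diag_refl_one]

theorem tensor_op_diag_one [Finite H] (φ : H ≃* G) :
    tensor (op (diag φ 1)) (diag φ 1) = unit H := by
  rw [op_diag_one, tensor_diag_one, MulEquiv.self_trans_symm, diag_refl_one]

theorem diag_one_mem_orth [Finite H] (φ : H ≃* G) : diag φ 1 ∈ orth G H :=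
  ⟨diag_mem_bifree φ 1, tensor_diag_one_op φ, tensor_op_diag_one φ⟩

theorem orth_nonempty_iff [Finite H] : (orth G H).Nonempty ↔ Nonempty (G ≃* H) :=
  ⟨fun ⟨_, hγ⟩ => nonempty_mulEquiv hγ.1 hγ.2.1, fun ⟨e⟩ => ⟨_, diag_one_mem_orth e.symm⟩⟩

/-- In the endomorphism ring `B(G, G)`, right inverses are left inverses. -/
theorem tensor_eq_unit_symm {a b : DoubleBurnside G G} (h : tensor a b = unit G) :
    tensor b a = unit G := by
  let f : DoubleBurnside G G →ₗ[ℤ] DoubleBurnside G G :=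
    ((AddMonoidHom.flip (tensor (G := G) (H := G) (K := G))) b).toIntLinearMap
  have hf : ∀ x, f x = tensor x b := fun _ => rfl
  have hs : Function.Surjective f := fun x => ⟨tensor x a, by
    rw [hf, tensor_assoc, h, tensor_unit]⟩
  -- Right multiplication by $b$ sends both $ba$ and $[G]$ to $b$.
  refine OrzechProperty.injective_of_surjective_endomorphism f hs ?_
  rw [hf, hf, tensor_assoc, h, tensor_unit, unit_tensor]

theorem tensor_op_eq_unit_symm [Finite H] {γ : DoubleBurnside G H} (hγ : γ ∈ bifree G H)
    (h : tensor γ (op γ) = unit G) : tensor (op γ) γ = unit H := by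
  obtain ⟨e⟩ := nonempty_mulEquiv hγ h
  -- Multiplying by the invertible $\tau\in B(H,G)$ moves $\gamma$ into $B(G,G)$; conjugating by
  -- $\tau$ afterwards moves the conclusion back to $B(H,H)$.
  set τ := diag e 1
  have h1 : tensor (tensor γ τ) (op (tensor γ τ)) = unit G := by
    rw [op_tensor, tensor_assoc, ← tensor_assoc τ, tensor_diag_one_op, unit_tensor, h]
  have h2 := tensor_eq_unit_symm h1
  rw [op_tensor] at h2
  calc tensor (op γ) γ
      = tensor (tensor τ (op τ)) (tensor (tensor (op γ) γ) (tensor τ (op τ))) := by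
        rw [tensor_diag_one_op, unit_tensor, tensor_unit]
    _ = tensor τ (tensor (tensor (tensor (op τ) (op γ)) (tensor γ τ)) (op τ)) := by
        simp only [tensor_assoc]
    _ = unit H := by rw [h2, unit_tensor, tensor_diag_one_op]

end DoubleBurnside

/-! ## A congruence for marks of bifree bisets -/

theorem card_orbit_mem_of_free {C E : Type*} [Group C] [MulAction C E]
    (h : ∀ (c : C) (x : E), c • x = x → c = 1) (S : Set (MulAction.orbitRel.Quotient C E)) :
    Nat.card {x : E // (Quotient.mk'' x : MulAction.orbitRel.Quotient C E) ∈ S} =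
      Nat.card S * Nat.card C := by
  rw [← Nat.card_prod]
  have hmk : ∀ (c : C) (x : E), (Quotient.mk'' (c • x) : MulAction.orbitRel.Quotient C E) =
      Quotient.mk'' x := fun c x => Quotient.sound' ⟨c, rfl⟩
  have hmem : ∀ s : S × C, (Quotient.mk'' (s.2 • Quotient.out s.1.1) :
      MulAction.orbitRel.Quotient C E) ∈ S := fun s => by
    rw [hmk, Quotient.out_eq']
    exact s.1.2
  refine (Nat.card_congr (Equiv.ofBijective
    (fun s : S × C => ⟨s.2 • Quotient.out s.1.1, hmem s⟩) ⟨?_, ?_⟩)).symm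
  · rintro ⟨⟨y, hy⟩, c⟩ ⟨⟨z, hz⟩, d⟩ hcd
    have h1 : c • Quotient.out y = d • Quotient.out z := Subtype.mk.inj hcd
    obtain rfl : y = z := by
      rw [← Quotient.out_eq' y, ← Quotient.out_eq' z,
        ← hmk c (Quotient.out y), ← hmk d (Quotient.out z), h1]
    rw [← inv_smul_eq_iff, smul_smul] at h1
    obtain rfl : d = c := inv_mul_eq_one.1 (h _ _ h1)
    rfl
  · rintro ⟨x, hx⟩
    have h1 : (Quotient.mk'' x : MulAction.orbitRel.Quotient C E) =
      Quotient.mk'' (Quotient.out (Quotient.mk'' x : MulAction.orbitRel.Quotient C E)) :=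
        (Quotient.out_eq' _).symm
    obtain ⟨c, hc⟩ := Quotient.exact' h1
    exact ⟨⟨⟨_, hx⟩, c⟩, Subtype.ext hc⟩

namespace FinGSet

variable {G H : Type u} [Group G] [Group H] {N : Type*} [Group N]

section Normalizing

variable (X : FinGSet (G × H)) (α : N →* G) (β : N →* H) (U : Subgroup N) [U.Normal]

/-- `N` acts on the points fixed by a normal subgroup `U`. -/
@[reducible]
def fixedByNormalAction :
    MulAction N (FixedBy ((α.comp U.subtype).prod (β.comp U.subtype)) X) where
  smul n x := ⟨((α n, β n) : G × H) • x.1, fun w => by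
    have hw : n⁻¹ * (w : N) * n ∈ U := by
      simpa using Subgroup.Normal.conj_mem ‹U.Normal› w.1 w.2 n⁻¹
    have h1 := x.2 ⟨_, hw⟩
    have h2 : ((α.comp U.subtype).prod (β.comp U.subtype)) w * ((α n, β n) : G × H) =
        (α n, β n) * ((α.comp U.subtype).prod (β.comp U.subtype)) ⟨n⁻¹ * (w : N) * n, hw⟩ := by
      ext <;> simp [mul_assoc]
    rw [smul_smul, h2, mul_smul, h1]⟩
  one_smul x := Subtype.ext (by
    change ((α 1, β 1) : G × H) • x.1 = x.1
    rw [map_one, map_one, ← Prod.one_eq_mk, one_smul])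
  mul_smul m n x := Subtype.ext (by
    change ((α (m * n), β (m * n)) : G × H) • x.1 =
      ((α m, β m) : G × H) • ((α n, β n) : G × H) • x.1
    rw [smul_smul, Prod.mk_mul_mk, map_mul, map_mul])

/-- The orbits of the centralizer of `α(U)` on the points fixed by `U`. -/
abbrev FixedOrbits : Type u :=
  MulAction.orbitRel.Quotient (homCentralizer (α.comp U.subtype))
    (FixedBy ((α.comp U.subtype).prod (β.comp U.subtype)) X)

theorem conj_mem_homCentralizer (n : N) {c : G} (hc : c ∈ homCentralizer (α.comp U.subtype)) :
    α n * c * (α n)⁻¹ ∈ homCentralizer (α.comp U.subtype) := by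
  rw [mem_homCentralizer] at hc ⊢
  intro w
  have hw : n⁻¹ * (w : N) * n ∈ U := by
    simpa using Subgroup.Normal.conj_mem ‹U.Normal› w.1 w.2 n⁻¹
  have h1 := hc ⟨_, hw⟩
  simp only [MonoidHom.comp_apply, Subgroup.subtype_apply, map_mul, map_inv] at h1 ⊢
  calc α w * (α n * c * (α n)⁻¹)
      = α n * ((α n)⁻¹ * α w * α n * c) * (α n)⁻¹ := by group
    _ = α n * c * (α n)⁻¹ * α w := by rw [h1]; group

/-- `N` acts on the orbits. -/
@[reducible]
def fixedOrbitsAction : MulAction N (FixedOrbits X α β U) :=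
  letI := fixedByNormalAction X α β U
  { smul := fun n => Quotient.map' (n • ·) (by
      rintro x y ⟨c, rfl⟩
      refine ⟨⟨_, conj_mem_homCentralizer α U n c.2⟩, Subtype.ext ?_⟩
      change ((α n * c.1 * (α n)⁻¹, 1) : G × H) • ((α n, β n) : G × H) • y.1 =
        ((α n, β n) : G × H) • ((c.1, 1) : G × H) • y.1
      simp [smul_smul])
    one_smul := by
      rintro ⟨x⟩
      exact congrArg (Quotient.mk'' ·) (one_smul N x)
    mul_smul := by
      rintro m n ⟨x⟩
      exact congrArg (Quotient.mk'' ·) (mul_smul m n x) }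

variable {X}

/-- The element $c^{-1}\alpha(n)$ is the value at $n$ of the modified homomorphism $\theta$ that
will fix $x$ together with $\beta$. -/
theorem mk_mem_fixed_iff (x : FixedBy ((α.comp U.subtype).prod (β.comp U.subtype)) X) (n : N) :
    letI := fixedOrbitsAction X α β U
    n • (Quotient.mk'' x : FixedOrbits X α β U) = Quotient.mk'' x ↔
      ∃ c ∈ homCentralizer (α.comp U.subtype), ((c⁻¹ * α n, β n) : G × H) • x.1 = x.1 := by
  refine Iff.trans Quotient.eq'' ?_
  constructor
  · rintro ⟨c, hc⟩
    refine ⟨c.1, c.2, ?_⟩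
    have h1 : ((c.1, 1) : G × H) • x.1 = ((α n, β n) : G × H) • x.1 := Subtype.ext_iff.1 hc
    have h2 : ((c.1⁻¹ * α n, β n) : G × H) = (c.1, 1)⁻¹ * (α n, β n) := by simp
    rw [h2, mul_smul, ← h1, inv_smul_smul]
  · rintro ⟨c, hc, h1⟩
    refine ⟨⟨c, hc⟩, Subtype.ext ?_⟩
    change ((c, 1) : G × H) • x.1 = ((α n, β n) : G × H) • x.1
    have h2 : ((c⁻¹ * α n, β n) : G × H) = (c, 1)⁻¹ * (α n, β n) := by simp
    rw [h2, mul_smul, inv_smul_eq_iff] at h1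
    exact h1.symm

/-- $U$ fixes the points themselves and hence their orbits, so the action factors through the
$p$-group $N/U$. -/
theorem card_fixedOrbits_modEq [Finite N] {p : ℕ} [Fact p.Prime]
    (hp : ∀ n : N, ∃ k, n ^ p ^ k ∈ U) :
    letI := fixedOrbitsAction X α β U
    Nat.card (FixedOrbits X α β U) ≡
      Nat.card {y : FixedOrbits X α β U | ∀ n : N, n • y = y} [MOD p] := by
  let := fixedOrbitsAction X α β U
  have htriv : ∀ n ∈ U, MulAction.toPermHom N (FixedOrbits X α β U) n = 1 := by
    intro n hn
    ext y
    induction y using Quotient.inductionOn' with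
    | _ x =>
      exact (mk_mem_fixed_iff α β U x n).2 ⟨1, one_mem _, by simpa using x.2 ⟨n, hn⟩⟩
  let f : N ⧸ U →* Equiv.Perm (FixedOrbits X α β U) :=
    QuotientGroup.lift U (MulAction.toPermHom N (FixedOrbits X α β U)) htriv
  let : MulAction (N ⧸ U) (FixedOrbits X α β U) := MulAction.compHom _ f
  have hP : IsPGroup p (N ⧸ U) := by
    intro g
    induction g using QuotientGroup.induction_on with
    | _ n =>
      obtain ⟨k, hk⟩ := hp n
      exact ⟨k, by rwa [← QuotientGroup.mk_pow, QuotientGroup.eq_one_iff]⟩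
  have h1 := hP.card_modEq_card_fixedPoints (FixedOrbits X α β U)
  convert h1 using 3
  ext y
  constructor
  · intro hy g
    induction g using QuotientGroup.induction_on with
    | _ n => exact hy n
  · intro hy n
    exact hy (n : N ⧸ U)

/-- Both sides count the points whose centralizer orbit is stable under $N$. For such a point $x$,
left freeness leaves for each $n$ exactly one $\theta(n)$ with $(\theta(n),\beta(n))x=x$; uniqueness
makes $\theta$ a homomorphism extending $\alpha|_U$. -/
theorem card_fixed_fixedOrbits [Fintype (N →* G)] [DecidableEq (U →* G)]
    (hX : ∀ (g : G) (x : X.carrier), ((g, 1) : G × H) • x = x → g = 1) :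
    letI := fixedOrbitsAction X α β U
    Nat.card {y : FixedOrbits X α β U | ∀ n : N, n • y = y} *
        Nat.card (homCentralizer (α.comp U.subtype)) =
      ∑ θ : N →* G with θ.comp U.subtype = α.comp U.subtype,
        Nat.card (FixedBy (θ.prod β) X) := by
  let := fixedOrbitsAction X α β U
  rw [← card_orbit_mem_of_free (fixedByAction_free hX _ _)]
  have huniq : ∀ (a b : G) (h : H) (x : X.carrier), ((a, h) : G × H) • x = x →
      ((b, h) : G × H) • x = x → a = b := by
    intro a b h x ha hb
    have h1 : ((b * a⁻¹, 1) : G × H) • x = x := by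
      have : ((b * a⁻¹, 1) : G × H) = (b, h) * (a, h)⁻¹ := by simp
      rw [this, mul_smul, inv_smul_eq_iff.2 ha.symm, hb]
    exact (mul_inv_eq_one.1 (hX _ _ h1)).symm
  have e : (Σ θ : {θ : N →* G // θ.comp U.subtype = α.comp U.subtype}, FixedBy (θ.1.prod β) X) ≃
      {x : FixedBy ((α.comp U.subtype).prod (β.comp U.subtype)) X //
        (Quotient.mk'' x : FixedOrbits X α β U) ∈
          {y : FixedOrbits X α β U | ∀ n : N, n • y = y}} := by
    refine Equiv.ofBijective (fun s => ⟨⟨s.2.1, fun w => ?_⟩, fun n => ?_⟩) ⟨?_, ?_⟩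
    · have h1 : s.1.1 w = α w := DFunLike.congr_fun s.1.2 w
      change ((α w, β w) : G × H) • s.2.1 = s.2.1
      rw [← h1]
      exact s.2.2 w
    -- This element centralizes $\alpha(U)$ because $\theta$ and $\alpha$ agree on $U$ and $n$
    -- normalizes $U$.
    · refine (mk_mem_fixed_iff α β U _ n).2 ⟨α n * (s.1.1 n)⁻¹, ?_, ?_⟩
      · rw [mem_homCentralizer]
        intro w
        have hw : n⁻¹ * (w : N) * n ∈ U := by
          simpa using Subgroup.Normal.conj_mem ‹U.Normal› w.1 w.2 n⁻¹
        have h1 : s.1.1 (n⁻¹ * w * n) = α (n⁻¹ * w * n) := DFunLike.congr_fun s.1.2 ⟨_, hw⟩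
        have h2 : s.1.1 w = α w := DFunLike.congr_fun s.1.2 w
        simp only [map_mul, map_inv, h2] at h1
        simp only [MonoidHom.comp_apply, Subgroup.subtype_apply]
        calc α w * (α n * (s.1.1 n)⁻¹)
            = α n * ((α n)⁻¹ * α w * α n) * (s.1.1 n)⁻¹ := by group
          _ = α n * (s.1.1 n)⁻¹ * α w := by rw [← h1]; group
      · have h1 : ((s.1.1 n, β n) : G × H) • s.2.1 = s.2.1 := s.2.2 n
        simpa using h1
    · rintro ⟨⟨θ, hθ⟩, ⟨x, hx⟩⟩ ⟨⟨θ', hθ'⟩, ⟨x', hx'⟩⟩ h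
      obtain rfl : x = x' := Subtype.mk.inj (Subtype.mk.inj h)
      obtain rfl : θ = θ' := MonoidHom.ext fun n => huniq _ _ _ x (hx n) (hx' n)
      rfl
    · rintro ⟨x, hx⟩
      choose c hc hcx using fun n => (mk_mem_fixed_iff α β U x n).1 (hx n)
      have hmul : ∀ m n, (c (m * n))⁻¹ * α (m * n) = (c m)⁻¹ * α m * ((c n)⁻¹ * α n) := by
        intro m n
        refine huniq _ _ (β (m * n)) x.1 (hcx (m * n)) ?_
        rw [map_mul, ← Prod.mk_mul_mk, mul_smul, hcx n, hcx m]
      refine ⟨⟨⟨MonoidHom.mk' (fun n => (c n)⁻¹ * α n) hmul, ?_⟩, ⟨x.1, hcx⟩⟩, rfl⟩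
      ext w
      exact huniq _ _ (β w) x.1 (hcx w) (x.2 w)
  rw [← Nat.card_congr e, Nat.card_sigma]
  exact (Finset.sum_subtype _ (fun θ => by simp)
    fun θ : N →* G => Nat.card (FixedBy (θ.prod β) X)).symm

end Normalizing

end FinGSet

namespace DoubleBurnside

variable {G H : Type u} [Group G] [Group H] {N : Type*} [Group N]

/-- With $C=C_G(\alpha(U))$ acting freely, the mark at $U$ is $|C|$ times the number of $C$-orbits,
and the sum is $|C|$ times the number of $N$-stable ones. These two numbers agree modulo $p$. -/
theorem dvd_mark_sub_sum [Finite N] [Fintype (N →* G)] (α : N →* G) (β : N →* H) (U : Subgroup N)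
    [U.Normal] [DecidableEq (U →* G)] {p : ℕ} [Fact p.Prime] (hp : ∀ n : N, ∃ k, n ^ p ^ k ∈ U)
    {a : DoubleBurnside G H} (ha : a ∈ bifree G H) :
    ((p * conjCount (α.comp U.subtype) (α.comp U.subtype) : ℕ) : ℤ) ∣
      (∑ θ : N →* G with θ.comp U.subtype = α.comp U.subtype, mark (θ.prod β) a) -
        mark ((α.comp U.subtype).prod (β.comp U.subtype)) a := by
  induction a, ha using bifree_induction with
  | h₂ => simp
  | h₃ a a' _ _ ha ha' =>
    simp only [map_add, Finset.sum_add_distrib]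
    rw [add_sub_add_comm]
    exact dvd_add ha ha'
  | h₄ a _ ha =>
    simp only [map_neg, Finset.sum_neg_distrib]
    rw [neg_sub_neg, ← dvd_neg, neg_sub]
    exact ha
  | h₁ X hX =>
    simp only [mark_cls]
    rw [← Nat.cast_sum, ← card_fixed_fixedOrbits α β U hX.1,
      card_dvd_of_free (fixedByAction_free hX.1 (α.comp U.subtype) (β.comp U.subtype)),
      card_homCentralizer]
    have h1 := (Nat.modEq_iff_dvd.1 (card_fixedOrbits_modEq (X := X) α β U hp))
    push_cast
    rw [← sub_mul]
    exact mul_dvd_mul_right h1 _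

end DoubleBurnside

/-! ## Nilpotent groups -/

/-- A proper subgroup of a finite nilpotent group is normal of `p`-power index in a larger one. -/
theorem exists_lt_normal_of_isNilpotent {H : Type*} [Group H] [Finite H] [Group.IsNilpotent H]
    {V : Subgroup H} (hV : V < ⊤) : ∃ (N : Subgroup H) (p : ℕ), p.Prime ∧ V < N ∧
      (V.subgroupOf N).Normal ∧ ∀ n ∈ N, n ^ p ∈ V := by
  have hlt : V < Subgroup.normalizer (V : Set H) :=
    Group.normalizerCondition_of_isNilpotent V hV
  set M := Subgroup.normalizer (V : Set H) with hM
  have hn : (V.subgroupOf M).Normal := Subgroup.normal_in_normalizer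
  have hnt : Nontrivial (M ⧸ V.subgroupOf M) := by
    rw [QuotientGroup.nontrivial_iff, Ne, Subgroup.subgroupOf_eq_top]
    exact hlt.not_ge
  have hp : (Nat.card (M ⧸ V.subgroupOf M)).minFac.Prime :=
    Nat.minFac_prime Finite.one_lt_card.ne'
  set p := (Nat.card (M ⧸ V.subgroupOf M)).minFac
  have := Fact.mk hp
  obtain ⟨x, hx⟩ := exists_prime_orderOf_dvd_card' (G := M ⧸ V.subgroupOf M) p (Nat.minFac_dvd _)
  let q : M →* M ⧸ V.subgroupOf M := QuotientGroup.mk' _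
  -- The preimage in the normalizer of $V$ of a subgroup of order $p$ of the quotient by $V$.
  let N : Subgroup H := ((Subgroup.zpowers x).comap q).map M.subtype
  have hVN : V ≤ N := fun v hv => ⟨⟨v, hlt.le hv⟩, by
    have h1 : q ⟨v, hlt.le hv⟩ = 1 := (QuotientGroup.eq_one_iff _).2 hv
    change q _ ∈ Subgroup.zpowers x
    rw [h1]
    exact one_mem _, rfl⟩
  have hNM : N ≤ M := Subgroup.map_subtype_le _
  refine ⟨N, p, hp, lt_of_le_not_ge hVN fun h => ?_,
    (Subgroup.normal_subgroupOf_iff_le_normalizer hVN).2 hNM, ?_⟩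
  · obtain ⟨m, rfl⟩ := QuotientGroup.mk'_surjective _ x
    have h1 : (m : H) ∈ V := h ⟨m, Subgroup.mem_zpowers _, rfl⟩
    have h2 : (QuotientGroup.mk' (V.subgroupOf M)) m = 1 := (QuotientGroup.eq_one_iff _).2 h1
    rw [h2, orderOf_one] at hx
    exact hp.one_lt.ne hx
  · rintro _ ⟨m, hm, rfl⟩
    obtain ⟨k, hk⟩ : q m ∈ Subgroup.zpowers x := hm
    have h1 : q (m ^ p) = 1 := by
      rw [map_pow, ← hk]
      change (x ^ k) ^ p = 1
      rw [← zpow_natCast, ← zpow_mul, mul_comm, zpow_mul, zpow_natCast, ← hx, pow_orderOf_eq_one,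
        one_zpow]
    exact (QuotientGroup.eq_one_iff (m ^ p)).1 h1

/-! ### Columns of marks and uniformity -/

namespace DoubleBurnside

variable {G H : Type u} [Group G] [Group H]

theorem mem_twistedDiag {φ : H ≃* G} {V : Subgroup H} {x : G × H} :
    x ∈ twistedDiag φ V ↔ x.2 ∈ V ∧ x.1 = φ x.2 := by
  constructor
  · rintro ⟨v, hv, rfl⟩
    exact ⟨hv, rfl⟩
  · rintro ⟨hx, h⟩
    exact ⟨x.2, hx, Prod.ext h.symm rfl⟩

theorem mark_comp_congr_range {W W' : Type*} [Group W] [Group W'] (φ : H →* G) {ρ : W →* H}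
    {ρ' : W' →* H} (h : ρ.range = ρ'.range) (a : DoubleBurnside G H) :
    mark ((φ.comp ρ).prod ρ) a = mark ((φ.comp ρ').prod ρ') a := by
  refine mark_congr_range ?_ a
  have h1 : (φ.comp ρ).prod ρ = (φ.prod (MonoidHom.id H)).comp ρ := rfl
  have h2 : (φ.comp ρ').prod ρ' = (φ.prod (MonoidHom.id H)).comp ρ' := rfl
  rw [h1, h2, MonoidHom.range_comp, MonoidHom.range_comp, h]

/-- Stabilizers in a bifree biset meet $G\times1$ trivially. -/
theorem coeff_eq_zero_of_mem_bifree {a : DoubleBurnside G H} (ha : a ∈ bifree G H)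
    {L : Subgroup (G × H)} {g : G} (hg : g ≠ 1) (hL : ((g, 1) : G × H) ∈ L) : coeff L a = 0 := by
  induction a, ha using bifree_induction with
  | h₂ => simp
  | h₃ a a' _ _ ha ha' => rw [map_add, ha, ha', add_zero]
  | h₄ a _ ha => rw [map_neg, ha, neg_zero]
  | h₁ X hX =>
    rw [coeff_cls, Nat.cast_eq_zero, orbitCount]
    convert Set.ncard_empty (Set X.carrier)
    rw [Set.eq_empty_iff_forall_notMem]
    rintro ω ⟨x, hx, -⟩
    rw [← hx] at hL
    exact hg (hX.1 g x hL)

variable [Finite G] [Finite H] {γ : DoubleBurnside G H}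

section Columns

variable {W : Type*} [Group W]

/-- Columns of $\gamma$ are rows of $\gamma^\circ$, which is orthogonal by the second identity in
`orth`. -/
theorem exists_mark_eq_right [Finite W] (hγ : γ ∈ orth G H) (β : W →* H) :
    ∃ (α₀ : W →* G) (ε : ℤ), ε ^ 2 = 1 ∧ ∀ α, mark (α.prod β) γ = ε * conjCount α α₀ := by
  obtain ⟨α₀, ε, hε, -, h⟩ := exists_mark_eq (γ := op γ) (op_mem_bifree hγ.1)
    (by rw [op_op]; exact hγ.2.2) β
  exact ⟨α₀, ε, hε, fun α => by rw [← h, mark_op]⟩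

theorem exists_mark_eq_of_mark_ne_zero [Finite W] (hγ : γ ∈ orth G H) {α : W →* G} {β : W →* H}
    (h : mark (α.prod β) γ ≠ 0) :
    ∃ ε : ℤ, ε ^ 2 = 1 ∧ ∀ θ, mark (θ.prod β) γ = ε * conjCount θ α := by
  obtain ⟨α₀, ε, hε, hm⟩ := exists_mark_eq_right hγ β
  obtain ⟨g, rfl⟩ := (mark_ne_zero_iff_of_eq hε (hm α)).1 h
  exact ⟨ε, hε, fun θ => by rw [hm, conjCount_conjHom_right]⟩

end Columns

/-- The column of $\beta$ is $\varepsilon$ times a conjugation count, so the sum in the congruence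
equals $\varepsilon\,|C_G(\alpha(U))|$. If the mark at $U$ were zero, $p$ would divide
$\varepsilon=\pm1$. -/
theorem mark_restrict_ne_zero (hγ : γ ∈ orth G H) {N : Type*} [Group N] [Finite N] {α : N →* G}
    {β : N →* H} (U : Subgroup N) [U.Normal] {p : ℕ} (hp : p.Prime)
    (hU : ∀ n : N, ∃ k, n ^ p ^ k ∈ U) (h : mark (α.prod β) γ ≠ 0) :
    mark ((α.comp U.subtype).prod (β.comp U.subtype)) γ ≠ 0 := by
  classical
  have := Fact.mk hp
  have := Fintype.ofFinite (N →* G)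
  obtain ⟨ε, hε, hm⟩ := exists_mark_eq_of_mark_ne_zero hγ h
  intro h0
  have h1 := dvd_mark_sub_sum α β U hU hγ.1
  -- Each $g$ centralizing $\alpha(U)$ is counted once, at $\theta=g\alpha g^{-1}$.
  have hsum : ∑ θ : N →* G with θ.comp U.subtype = α.comp U.subtype, conjCount θ α =
      conjCount (α.comp U.subtype) (α.comp U.subtype) := by
    have e : {g : G // α.comp U.subtype = conjHom g (α.comp U.subtype)} ≃
        Σ θ : {θ : N →* G // θ.comp U.subtype = α.comp U.subtype}, {g : G // θ.1 = conjHom g α} :=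
      { toFun := fun g => ⟨⟨conjHom g.1 α, g.2.symm⟩, g.1, rfl⟩
        invFun := fun s => ⟨s.2.1, s.1.2.symm.trans (congrArg (·.comp U.subtype) s.2.2)⟩
        left_inv := fun _ => rfl
        right_inv := by
          rintro ⟨⟨θ, hθ⟩, g, hg⟩
          change θ = conjHom g α at hg
          subst hg
          rfl }
    rw [conjCount, Nat.card_congr e, Nat.card_sigma]
    exact Finset.sum_subtype _ (fun θ => by simp) fun θ : N →* G => conjCount θ α
  simp only [hm] at h1
  rw [h0, sub_zero, ← Finset.mul_sum, ← Nat.cast_sum, hsum] at h1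
  have hc : (conjCount (α.comp U.subtype) (α.comp U.subtype) : ℤ) ≠ 0 :=
    Nat.cast_ne_zero.2 (conjCount_self_pos _).ne'
  rw [Nat.cast_mul] at h1
  have h2 : (p : ℤ) ∣ ε := Int.dvd_of_mul_dvd_mul_right hc h1
  have h3 : (p : ℤ) ∣ 1 := by
    rw [← hε]
    exact dvd_pow h2 two_ne_zero
  exact hp.one_lt.ne' (by exact_mod_cast Int.eq_one_of_dvd_one (by positivity) h3)

/-- Descent from $H$: a proper $V$ is normal of $p$-power index in some larger $N$, where the claim
is already known. -/
theorem mark_comp_ne_zero [Group.IsNilpotent H] (hγ : γ ∈ orth G H) {φ : H →* G}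
    (h : mark (φ.prod (MonoidHom.id H)) γ ≠ 0) (V : Subgroup H) :
    mark ((φ.comp V.subtype).prod V.subtype) γ ≠ 0 := by
  induction V using WellFoundedGT.induction with
  | _ V ih =>
    rcases eq_or_lt_of_le (le_top : V ≤ ⊤) with rfl | hV
    · rwa [mark_comp_congr_range φ (ρ' := MonoidHom.id H)
        (by rw [Subgroup.range_subtype, MonoidHom.range_eq_map, Subgroup.map_id])]
    · obtain ⟨N, p, hp, hlt, hnormal, hpow⟩ := exists_lt_normal_of_isNilpotent hV
      have h1 := mark_restrict_ne_zero hγ (V.subgroupOf N) hp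
        (fun n => ⟨1, by simpa [Subgroup.mem_subgroupOf] using hpow n.1 n.2⟩) (ih N hlt)
      have h2 : (N.subtype.comp (V.subgroupOf N).subtype).range = V.subtype.range := by
        rw [MonoidHom.range_comp, Subgroup.range_subtype, Subgroup.range_subtype,
          Subgroup.subgroupOf_map_subtype, inf_eq_left]
        exact hlt.le
      rw [MonoidHom.comp_assoc, mark_comp_congr_range φ h2] at h1
      exact h1

/-- If `H` is nilpotent, an orthogonal element with non-zero mark at the full twisted diagonal of `φ`
is uniform with respect to `φ`. -/
theorem mem_closure_twistedDiag [Group.IsNilpotent H] (hγ : γ ∈ orth G H) {φ : H ≃* G}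
    (h : mark (φ.toMonoidHom.prod (MonoidHom.id H)) γ ≠ 0) :
    γ ∈ AddSubgroup.closure (Set.range fun V : Subgroup H => cls (coset (twistedDiag φ V))) := by
  let F : Set (Subgroup (G × H)) :=
    {L | ∃ k : G × H, L.map (MulAut.conj k).toMonoidHom ≤ twistedDiag φ ⊤}
  have h1 := mem_closure_of_mark_eq_zero F
    (fun K L hKL ⟨k, hk⟩ => ⟨k, (Subgroup.map_mono hKL).trans hk⟩) γ ?_
  · refine (AddSubgroup.closure_mono ?_) h1
    rintro _ ⟨L, ⟨k, hk⟩, rfl⟩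
    -- A subgroup of $\Delta(G,\varphi,H)$ is the twisted diagonal of its preimage under
    -- $v\mapsto(\varphi(v),v)$.
    refine ⟨(L.map (MulAut.conj k).toMonoidHom).comap
      (φ.toMonoidHom.prod (MonoidHom.id H)), cls_eq (Iso.symm ?_)⟩
    have h2 : twistedDiag φ ((L.map (MulAut.conj k).toMonoidHom).comap
        (φ.toMonoidHom.prod (MonoidHom.id H))) = L.map (MulAut.conj k).toMonoidHom := by
      refine Subgroup.map_comap_eq_self ?_
      rw [MonoidHom.range_eq_map]
      exact hk
    rw [h2]
    exact coset_iso_of_conj ⟨k, rfl⟩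
  · intro L hL
    by_contra hne
    rw [subtype_eq_prod] at hne
    set α := (MonoidHom.fst G H).comp L.subtype with hα
    set β := (MonoidHom.snd G H).comp L.subtype with hβ
    -- The column of $\beta$ is already non-zero at $\varphi\beta$, so a non-zero entry at $\alpha$
    -- forces $\alpha$ to be conjugate to $\varphi\beta$; then $L$ is conjugate into
    -- $\Delta(G,\varphi,H)$.
    have h2 : mark ((φ.toMonoidHom.comp β).prod β) γ ≠ 0 := by
      rw [mark_comp_congr_range φ.toMonoidHom (Subgroup.range_subtype β.range).symm]
      exact mark_comp_ne_zero hγ h _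
    obtain ⟨ε, hε, hm⟩ := exists_mark_eq_of_mark_ne_zero hγ h2
    obtain ⟨g, hg⟩ := (mark_ne_zero_iff_of_eq hε (hm α)).1 hne
    refine hL ⟨(g⁻¹, 1), ?_⟩
    rintro _ ⟨l, hl, rfl⟩
    rw [mem_twistedDiag]
    refine ⟨Subgroup.mem_top _, ?_⟩
    have h3 : l.1 = g * φ l.2 * g⁻¹ := DFunLike.congr_fun hg (⟨l, hl⟩ : L)
    simp [h3, mul_assoc]

/-! ## The full twisted diagonals occurring in an orthogonal element -/

/-- A subgroup properly containing $\Delta(G,\psi,H)$ contains some $(g,1)$ with $g\neq1$, so its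
coefficient in a bifree element vanishes and triangularity reduces the mark to a single term. -/
theorem coeff_twistedDiag_ne_zero_iff {a : DoubleBurnside G H} (ha : a ∈ bifree G H)
    (ψ : H ≃* G) : coeff (twistedDiag ψ ⊤) a ≠ 0 ↔
      mark (ψ.toMonoidHom.prod (MonoidHom.id H)) a ≠ 0 := by
  have h1 : (twistedDiag ψ ⊤).subtype.range = (ψ.toMonoidHom.prod (MonoidHom.id H)).range := by
    rw [Subgroup.range_subtype, MonoidHom.range_eq_map]
    rfl
  rw [← mark_congr_range h1, mark_eq_coeff_mul, mul_ne_zero_iff,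
    and_iff_left (mark_coset_self_ne_zero _)]
  intro L hL
  obtain ⟨x, hxL, hx⟩ := SetLike.exists_of_lt hL
  refine coeff_eq_zero_of_mem_bifree ha (g := x.1 * (ψ x.2)⁻¹) ?_ ?_
  · intro h
    exact hx (mem_twistedDiag.2 ⟨Subgroup.mem_top _, mul_inv_eq_one.1 h⟩)
  · have h2 : (ψ x.2, x.2) ∈ L := hL.le (mem_twistedDiag.2 ⟨Subgroup.mem_top _, rfl⟩)
    simpa [Prod.mul_def] using mul_mem hxL (inv_mem h2)

/-- The column of the identity of $H$ is supported on one $G$-conjugacy class of homomorphisms, and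
bifreeness makes these bijective. -/
theorem exists_mulEquiv_mark (hγ : γ ∈ orth G H) : ∃ φ : H ≃* G, ∀ ψ : H ≃* G,
    mark (ψ.toMonoidHom.prod (MonoidHom.id H)) γ ≠ 0 ↔ ∃ g : G, ψ = φ.trans (MulAut.conj g) := by
  obtain ⟨β₀, ε, hε, hm⟩ := exists_mark_eq_right hγ (MonoidHom.id H)
  have hne := (mark_ne_zero_iff_of_eq hε (hm β₀)).2 ⟨1, (conjHom_one _).symm⟩
  rw [← mark_op] at hne
  have hb := bijective_of_mark_ne_zero (γ := op γ) (op_mem_bifree hγ.1)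
    (by rw [op_op]; exact hγ.2.2) hne
  refine ⟨MulEquiv.ofBijective β₀ hb, fun ψ => (mark_ne_zero_iff_of_eq hε (hm _)).trans
    (exists_congr fun g => ?_)⟩
  rw [MonoidHom.ext_iff, MulEquiv.ext_iff]
  rfl

theorem isUniform_of_mem_orth (hG : Group.IsNilpotent G) (hγ : γ ∈ orth G H) : IsUniform γ := by
  obtain ⟨φ, hφ⟩ := exists_mulEquiv_mark hγ
  have : Group.IsNilpotent H := Group.nilpotent_of_mulEquiv φ.symm
  refine ⟨φ, mem_closure_twistedDiag hγ ((hφ φ).2 ⟨1, ?_⟩)⟩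
  ext
  simp

/-! ## The group of orthogonal units -/

theorem tensor_diag (φ ψ : MulAut G) (a b : Burnside G) :
    tensor (diag φ a) (diag ψ b) = diag (φ * ψ) (a * twistHom φ b) := by
  induction a using Burnside.induction with
  | h₂ a a' ha ha' => rw [map_sub, tensor_sub_left, ha, ha', sub_mul, map_sub]
  | h₁ X =>
    induction b using Burnside.induction with
    | h₂ b b' hb hb' => rw [map_sub, map_sub, hb, hb', map_sub, mul_sub, map_sub]
    | h₁ Y =>
      rw [diag_cls, diag_cls, tensor_cls, twistHom_cls, cls_mul, diag_cls]
      -- By definition `ψ.trans φ` is `φ * ψ`, and `transport φ` is `twist φ` for automorphisms.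
      exact cls_eq (tensor_twistedBiset φ ψ X Y)

theorem op_diag (φ : MulAut G) (a : Burnside G) : op (diag φ a) = diag φ⁻¹ (twistHom φ⁻¹ a) := by
  induction a using Burnside.induction with
  | h₂ a a' ha ha' => rw [map_sub, map_sub, ha, ha', map_sub, map_sub]
  | h₁ X =>
    rw [diag_cls, op_cls, twistHom_cls, diag_cls]
    exact cls_eq (op_twistedBiset φ X)

theorem tensor_diag_op (φ : MulAut G) (a : Burnside G) :
    tensor (diag φ a) (op (diag φ a)) = diag 1 (a * a) := by
  rw [op_diag, tensor_diag, mul_inv_cancel, ← twistHom_mul_apply, mul_inv_cancel,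
    twistHom_one_apply]

theorem tensor_op_diag (φ : MulAut G) (a : Burnside G) :
    tensor (op (diag φ a)) (diag φ a) = diag 1 (twistHom φ⁻¹ (a * a)) := by
  rw [op_diag, tensor_diag, inv_mul_cancel, twistHom_map_mul]

theorem diag_one_one : diag (1 : MulAut G) 1 = unit G := diag_refl_one

/-- The orthogonal unit with class `φ` in `Aut(G)` and coefficient `v`. -/
def diagUnit (φ : MulAut G) (v : (Burnside G)ˣ) : OrthUnit G :=
  ⟨diag φ v, diag_mem_bifree φ _,
    by rw [tensor_diag_op, units_mul_self, diag_one_one],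
    by rw [tensor_op_diag, units_mul_self, twistHom_map_one, diag_one_one]⟩

theorem diagUnit_mul (φ ψ : MulAut G) (v w : (Burnside G)ˣ) :
    diagUnit φ v * diagUnit ψ w = diagUnit (φ * ψ) (v * outUnits G (φ : Out G) w) :=
  Subtype.ext (tensor_diag φ ψ v w)

theorem diagUnit_congr {φ ψ : MulAut G} (h : (φ : Out G) = ψ) (v : (Burnside G)ˣ) :
    diagUnit φ v = diagUnit ψ v := by
  rw [QuotientGroup.eq] at h
  obtain ⟨g, hg⟩ := h
  have h1 : ψ = φ * MulAut.conj g := by rw [hg, mul_inv_cancel_left]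
  rw [h1]
  exact Subtype.ext (diag_conj φ g v).symm

/-- The homomorphism `B(G)ˣ ⋊ Out(G) → B^Δ_∘(G, G)`. -/
def semidirectHom (G : Type u) [Group G] [Finite G] :
    (Burnside G)ˣ ⋊[outUnits G] Out G →* OrthUnit G :=
  MonoidHom.mk' (fun s => Quotient.liftOn' s.right (fun φ => diagUnit φ s.left)
      fun _ _ h => diagUnit_congr (Quotient.sound' h) _) (by
    rintro ⟨v, x⟩ ⟨w, y⟩
    induction x using QuotientGroup.induction_on with
    | _ φ =>
      induction y using QuotientGroup.induction_on with
      | _ ψ => exact (diagUnit_mul φ ψ v w).symm)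

theorem semidirectHom_apply (φ : MulAut G) (v : (Burnside G)ˣ) :
    semidirectHom G ⟨v, (φ : Out G)⟩ = diagUnit φ v := rfl

theorem semidirectHom_injective : Function.Injective (semidirectHom G) := by
  rw [injective_iff_map_eq_one]
  rintro ⟨v, x⟩ h
  induction x using QuotientGroup.induction_on with
  | _ φ =>
    have h1 : diag φ (v : Burnside G) = unit G := Subtype.ext_iff.1 h
    -- At the pair of identities $[G]$ has mark $|Z(G)|\neq0$, so some $g$ conjugates $\varphi$ to
    -- the identity and $\varphi$ is inner.
    have h2 := mark_diag φ (v : Burnside G) (MonoidHom.id G) (MonoidHom.id G)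
    rw [h1, mark_unit] at h2
    have h3 : conjCount (MonoidHom.id G) (φ.toMonoidHom.comp (MonoidHom.id G)) ≠ 0 := by
      intro h0
      rw [h0, Nat.cast_zero, mul_zero, Nat.cast_eq_zero] at h2
      exact (conjCount_self_pos _).ne' h2
    obtain ⟨g, hg⟩ := conjCount_ne_zero_iff.1 h3
    have h4 : φ = MulAut.conj g⁻¹ := by
      ext x
      have h5 : x = g * φ x * g⁻¹ := DFunLike.congr_fun hg x
      rw [MulAut.conj_apply]
      nth_rw 2 [h5]
      group
    have h6 : (φ : Out G) = (1 : MulAut G) := by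
      rw [eq_comm, QuotientGroup.eq, inv_one, one_mul, h4]
      exact ⟨_, rfl⟩
    rw [semidirectHom_apply, diagUnit_congr h6] at h
    have h7 : diag (1 : MulAut G) (v : Burnside G) = diag (1 : MulAut G) 1 :=
      (Subtype.ext_iff.1 h).trans diag_one_one.symm
    have h8 : v = 1 := Units.ext (diag_injective _ h7)
    rw [h6, h8]
    rfl

/-- Uniformity puts $\gamma$ in the image of some `diag φ`, and orthogonality then reads $a^2=1$, so
that $a$ is a unit. -/
theorem semidirectHom_surjective (hG : Group.IsNilpotent G) :
    Function.Surjective (semidirectHom G) := by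
  rintro ⟨γ, hγ⟩
  obtain ⟨φ, hφ⟩ := isUniform_of_mem_orth hG hγ
  obtain ⟨a, rfl⟩ : γ ∈ (diag φ).range := by
    refine (AddSubgroup.closure_le _).2 ?_ hφ
    rintro _ ⟨V, rfl⟩
    exact ⟨_, diag_coset φ V⟩
  have h1 : a * a = 1 := by
    have h2 := hγ.2.1
    rw [tensor_diag_op, ← diag_one_one] at h2
    exact diag_injective _ h2
  exact ⟨⟨⟨a, a, h1, h1⟩, ((φ : MulAut G) : Out G)⟩, Subtype.ext rfl⟩

end DoubleBurnside

end

end BurnsideBiset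

/-! ### The theorem -/

theorem theorem1p1 (G H : Type u) [Group G] [Finite G] [Group H] [Finite H] :
    -- (a)
    (∀ γ ∈ BurnsideBiset.DoubleBurnside.bifree G H,
      BurnsideBiset.DoubleBurnside.tensor γ (BurnsideBiset.DoubleBurnside.op γ) =
          BurnsideBiset.DoubleBurnside.unit G →
        BurnsideBiset.DoubleBurnside.tensor (BurnsideBiset.DoubleBurnside.op γ) γ =
            BurnsideBiset.DoubleBurnside.unit H ∧
          γ ∈ BurnsideBiset.DoubleBurnside.orth G H) ∧
    -- (b)
    (BurnsideBiset.DoubleBurnside.orth G H).Finite ∧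
    -- (c)
    ((BurnsideBiset.DoubleBurnside.orth G H).Nonempty ↔ Nonempty (G ≃* H)) ∧
    -- (d)
    (∀ γ ∈ BurnsideBiset.DoubleBurnside.orth G H,
      ∃ φ : H ≃* G, ∀ ψ : H ≃* G,
        BurnsideBiset.Burnside.coeff (BurnsideBiset.DoubleBurnside.twistedDiag ψ ⊤) γ ≠ 0 ↔
          ∃ g : G, ψ = φ.trans (MulAut.conj g)) ∧
    (Group.IsNilpotent G → ∀ γ ∈ BurnsideBiset.DoubleBurnside.orth G H,
      BurnsideBiset.DoubleBurnside.IsUniform γ) ∧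
    -- (e)
    (Group.IsNilpotent G →
      Nonempty (BurnsideBiset.DoubleBurnside.OrthUnit G ≃*
        (BurnsideBiset.Burnside G)ˣ ⋊[BurnsideBiset.outUnits G] BurnsideBiset.Out G)) := by
  refine ⟨fun γ hγ h => ?_, BurnsideBiset.DoubleBurnside.finite_orth,
    BurnsideBiset.DoubleBurnside.orth_nonempty_iff, fun γ hγ => ?_,
    fun hG γ hγ => BurnsideBiset.DoubleBurnside.isUniform_of_mem_orth hG hγ, fun hG => ?_⟩
  · have h' := BurnsideBiset.DoubleBurnside.tensor_op_eq_unit_symm hγ h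
    exact ⟨h', hγ, h, h'⟩
  · obtain ⟨φ, hφ⟩ := BurnsideBiset.DoubleBurnside.exists_mulEquiv_mark hγ
    exact ⟨φ, fun ψ =>
      (BurnsideBiset.DoubleBurnside.coeff_twistedDiag_ne_zero_iff hγ.1 ψ).trans (hφ ψ)⟩
  · exact ⟨(MulEquiv.ofBijective (BurnsideBiset.DoubleBurnside.semidirectHom G)
      ⟨BurnsideBiset.DoubleBurnside.semidirectHom_injective,
        BurnsideBiset.DoubleBurnside.semidirectHom_surjective hG⟩).symm⟩
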